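/- **Proposition (Orthogonal group).** Labels are in $\{0,1\}$. Let $\omega,r_0,p_0,C_\rho,C_\beta,\beta>0$ and $0<\rho\le 1$. There are constants $K_l=K_l(1),\,K_u=K_u(1),\,K,\,K'>0$, depending only on these numbers (in particular not on $d$), with the following property. Let $d$ be any dimension and let $(X,Y)$ be a random pair in $\mathbb R^d\times\{0,1\}$ with law $\mu$ and regression function $\eta(x)=\mathbb P(Y=1\mid X=x)$. Let $f=\eta^*=\mathbf 1[\eta\ge 1/2]$ be the true-labeling function, i.e. the Bayes-optimal classifier (deterministic labels $Y=f(X)$ are the case $\eta=f$). Suppose that $f$ is $SO(d)$-invariant: $f(Ax)=f(x)$ for all $A\in SO(d)$ and $x\in\mathbb R^d$. (For $d=1$, where $SO(1)$ is trivial, suppose moreover $f(-x)=f(x)$, so that the norm retains the class.) Let $\mathcal F(x)=\|x\|_2$, and suppose that the one-dimensional represented data $(\mathcal F(X),Y)$ satisfy, for some measurable $\mathcal X\subseteq\mathbb R$ and some version $\bar\eta$ of $r\mapsto\mathbb P(Y=1\mid \mathcal F(X)=r)$: * (support regularity) $\mathrm{Vol}(\mathcal X\cap B(x,r))\ge\omega\,\mathrm{Vol}(B(x,r))$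 for $x\in\mathcal X$, $0<r<r_0$; * $\mathcal F(X)$ has a density with respect to Lebesgue measure that vanishes off $\mathcal X$ and is at least $p_0$ on $\mathcal X$; * (Hölder) $|\bar\eta(x)-\bar\eta(x')|\le C_\rho|x-x'|^\rho$ for $x,x'\in\mathcal X$; * (Tsybakov noise condition) $\mathbb P(|\bar\eta(\mathcal F(X))-\tfrac12|<t)\le C_\beta t^\beta$ for all $t>0$. Let $n\ge 1$ and $0<\nu<1$. The training sample consists of $n$ i.i.d. uncorrupted examples drawn from $\mu$ and a finite set $\mathcal C$ of corrupted examples, with arbitrary features and labels. Let $\Delta(\mathcal C)=\min_{c\ne c'\in\mathcal C}|\mathcal F(c)-\mathcal F(c')|$ ($=\infty$ if $|\mathcal C|\le 1$) be the minimum distance between the represented features of the corrupted examples. Let $\eta_k$ be the $k$-NN majority classifier on this sample that uses the distances $|\mathcal F(x)-\mathcal F(x')|$ (equidistant neighbours all included, even votes decided as $1$). Then, with probability at least $1-\nu$ over the uncorrupted examples, simultaneously for every $\mathcal C$ and every $k$ that satisfies the range condition of dimension $1$, $$K_l(1)\,\log^2(1/\nu)\,n^{\frac{\rho}{\rho+1}}\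 \le\ k\ \le\ K_u(1)\,\Delta(\mathcal C)\,n,$$ the classifier $\eta_k$ approximates the Bayes-optimal classifier of $(X,Y)$ at the one-dimensional rate: $$\mathbb P_X\big(\eta_k(X)\ne\eta^*(X)\big)\le K\lambda^\beta,\qquad R_X-R^*\le K'\lambda^{\beta+1},\qquad \lambda=\sqrt{\frac{\log n+\log(1/\nu)}{k}}+\Big(\frac kn\Big)^{\rho},$$ where $R_X=\mathbb P(\eta_k(X)\ne Y)$ and $R^*$ is the infimum of $\mathbb P(g(X)\ne Y)$ over all measurable $g:\mathbb R^d\to\{0,1\}$. In particular, if some $k$ satisfies the range condition in dimension $1$ for given $n,\nu,\rho$ and $\Delta$, then this same $k$ works for all dimensions $d$. -/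

import Mathlib

open MeasureTheory
open scoped ENNReal Matrix

noncomputable section

namespace InvariantKNN

/-! ### Binary classification: labels are Booleans, `true` being class `1`.
A data distribution is the joint law of (feature, label), a measure on `E × Bool`. -/

section Classification

variable {E : Type*} [MeasurableSpace E]

/-- `η` is a version of the regression function `x ↦ P(Y = 1 | X = x)` of the joint law `Q`. -/
structure IsRegressionFunction (Q : Measure (E × Bool)) (η : E → ℝ) : Prop where
  measurable : Measurable η
  mem_Icc : ∀ x, η x ∈ Set.Icc (0 : ℝ) 1
  apply_eq : ∀ A : Set E, MeasurableSet A →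
    Q (A ×ˢ {true}) = ∫⁻ x in A, ENNReal.ofReal (η x) ∂(Q.map Prod.fst)

/-- The Bayes-optimal classifier `1[η(x) ≥ 1/2]`. -/
def bayesClassifier {E : Type*} (η : E → ℝ) (x : E) : Bool :=
  decide ((1 : ℝ) / 2 ≤ η x)

/-- The risk `P(g(X) ≠ Y)` of a classifier. -/
def risk (Q : Measure (E × Bool)) (g : E → Bool) : ℝ :=
  Q.real {p | g p.1 ≠ p.2}

/-- The Bayes risk: the infimum of the risk over all measurable classifiers. -/
def bayesRisk (Q : Measure (E × Bool)) : ℝ :=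
  ⨅ g : {g : E → Bool // Measurable g}, risk Q g

end Classification

/-- Support regularity, density bounded below, Hölder continuity and the Tsybakov noise
condition, for the joint law `Q` with feature space `X` and regression function `η`. -/
structure RegularData {E : Type*} [PseudoMetricSpace E] [MeasureSpace E]
    (Q : Measure (E × Bool)) (X : Set E) (η : E → ℝ) (ω r₀ p₀ Cρ ρ Cβ β : ℝ) : Prop where
  measurableSet : MeasurableSet X
  regression : IsRegressionFunction Q η
  support_regular : ∀ x ∈ X, ∀ r : ℝ, 0 < r → r < r₀ →
    ENNReal.ofReal ω * volume (Metric.closedBall x r) ≤ volume (X ∩ Metric.closedBall x r)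
  density_bounded_below : ∃ p : E → ℝ≥0∞, Measurable p ∧
    Q.map Prod.fst = (volume.restrict X).withDensity p ∧
    ∀ x ∈ X, ENNReal.ofReal p₀ ≤ p x
  holder : ∀ x ∈ X, ∀ x' ∈ X, |η x - η x'| ≤ Cρ * dist x x' ^ ρ
  tsybakov : ∀ t : ℝ, 0 < t → (Q.map Prod.fst).real {x | |η x - 1 / 2| < t} ≤ Cβ * t ^ β

/-! ### The `k`-nearest-neighbour classifier -/

section KNN

variable {Z ι : Type*} [PseudoMetricSpace Z] [Fintype ι]

open Classical in
/-- The `k` nearest neighbours of `z` among the points `pts`, ties included: the indices `i` such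
that fewer than `k` points are strictly closer to `z` than `pts i`. This is the set of points in
the smallest closed ball around `z` that holds at least `k` points. -/
def knnSet (k : ℕ) (pts : ι → Z) (z : Z) : Finset ι :=
  Finset.univ.filter fun i =>
    (Finset.univ.filter fun j => dist (pts j) z < dist (pts i) z).card < k

/-- The `k`-NN classifier: `1` iff at least half of the nearest neighbours have label `1`. -/
def knnClassifier (k : ℕ) (pts : ι → Z) (labels : ι → Bool) (z : Z) : Bool :=
  decide ((knnSet k pts z).card ≤ 2 * ((knnSet k pts z).filter fun i => labels i = true).card)

/-- The `k`-NN classifier on `E` that measures distances between the representations `F x`.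
The training sample consists of the `n` examples `S` together with the `m` examples `c`. -/
def repKnnClassifier {E : Type*} (F : E → Z) (k : ℕ) {n m : ℕ}
    (S : Fin n → E × Bool) (c : Fin m → E × Bool) (x : E) : Bool :=
  knnClassifier k (Sum.elim (fun i => F (S i).1) (fun j => F (c j).1))
    (Sum.elim (fun i => (S i).2) (fun j => (c j).2)) (F x)

/-- Minimum pairwise distance of a finite family of points (`∞` if it has at most one member). -/
def minPairwiseDist (pts : ι → Z) : ℝ≥0∞ :=
  ⨅ (i : ι) (j : ι) (_ : i ≠ j), edist (pts i) (pts j)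

end KNN

/-- The condition `K_l log²(1/ν) n^{ρ/(ρ+d)} ≤ k ≤ K_u Δ^d n` on `k` in dimension `d`. -/
def KRange (Kl Ku ρ ν : ℝ) (d n : ℕ) (Δ : ℝ≥0∞) (k : ℕ) : Prop :=
  Kl * Real.log (1 / ν) ^ 2 * (n : ℝ) ^ (ρ / (ρ + d)) ≤ k ∧
    (k : ℝ≥0∞) ≤ ENNReal.ofReal Ku * Δ ^ d * n

/-- The rate `√((log n + log(1/ν)) / k) + (k/n)^{ρ/d}` in dimension `d`. -/
def rate (ρ ν : ℝ) (d n k : ℕ) : ℝ :=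
  √((Real.log n + Real.log (1 / ν)) / k) + ((k : ℝ) / n) ^ (ρ / d)

/-- Invariance of a labeling function on `ℝ^d` under the rotation group `SO(d)`. -/
def SOInvariant {d : ℕ} (f : EuclideanSpace ℝ (Fin d) → Bool) : Prop :=
  ∀ A ∈ Matrix.specialOrthogonalGroup (Fin d) ℝ, ∀ x : EuclideanSpace ℝ (Fin d),
    f (WithLp.toLp 2 (A *ᵥ x.ofLp)) = f x

/-- The law of `(‖X‖₂, Y)` when `(X, Y)` has law `μ`: the represented, one-dimensional data. -/
def normLaw {d : ℕ} (μ : Measure (EuclideanSpace ℝ (Fin d) × Bool)) : Measure (ℝ × Bool) :=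
  μ.map fun p => (‖p.1‖, p.2)

end InvariantKNN

end

/-! The norm loses nothing. For `d ≥ 2` the rotation group is transitive on spheres (evenness
replaces this when `d = 1`), so the Bayes rule factors through `‖x‖`. It then agrees almost surely
with the Bayes rule of the represented data (`bayesClassifier_ae_eq_of_factor`). Error and excess
risk are therefore those of a `k`-NN rule on the line (`SOInvariant.error_eq`), where `d` no longer
appears.

On the line, put `L = log n + log(1/ν)`, `c = 4/(p₀ω)` and `s = ck/n`. For `n ≥ 2`, with probability
at least `1 - ν` the clean sample is good (`RegularData.measure_not_isGoodSample_le`): for the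
relevant `k`, every point of the support has `k` clean points within `4s`, and over every interval
between two sample points the label sum deviates from its conditional mean by less than `√(2L ·
card)`. Goodness does not involve the corrupted examples, which makes the conclusion uniform in
them.

The upper bound on `k` separates corrupted features by more than `8s`, so at most one of them is a
neighbour. The clean neighbours fill an interval between two sample points. Their average label thus
errs by a bias of order `(k/n)^ρ`, a fluctuation of order `√(L/k)` and one stray vote of order
`1/k`, all at most a constant times the rate. The vote is correct wherever the margin exceeds that
amount (`knnClassifier_eq_bayesClassifier`, `IsGoodSample.knnClassifier_eq`), and the noise
condition bounds the rest (`RegularData.error_bounds`). Above a fixed threshold of the rate, the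
constants make both bounds trivial. -/

namespace InvariantKNN

/-! ### Risk, Bayes risk and excess risk -/

section Risk

variable {E : Type*} [MeasurableSpace E] {Q : Measure (E × Bool)} {η : E → ℝ}

theorem IsRegressionFunction.measurable_bayesClassifier (hη : IsRegressionFunction Q η) :
    Measurable (bayesClassifier η) := by
  refine measurable_to_bool ?_
  have : bayesClassifier η ⁻¹' {true} = {x | (1 : ℝ) / 2 ≤ η x} := by
    ext x; simp [bayesClassifier]
  rw [this]
  exact measurableSet_le measurable_const hη.measurable

variable [IsProbabilityMeasure Q]

instance isProbabilityMeasure_map_fst : IsProbabilityMeasure (Q.map Prod.fst) :=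
  Measure.isProbabilityMeasure_map (by fun_prop)

theorem IsRegressionFunction.integrable (hη : IsRegressionFunction Q η) :
    Integrable η (Q.map Prod.fst) :=
  Integrable.of_mem_Icc 0 1 hη.measurable.aemeasurable (.of_forall hη.mem_Icc)

theorem IsRegressionFunction.real_prod_true (hη : IsRegressionFunction Q η) {A : Set E}
    (hA : MeasurableSet A) :
    Q.real (A ×ˢ {true}) = ∫ x in A, η x ∂(Q.map Prod.fst) := by
  rw [measureReal_def, hη.apply_eq A hA, ← ofReal_integral_eq_lintegral_ofReal
    hη.integrable.integrableOn (.of_forall fun x => (hη.mem_Icc x).1), ENNReal.toReal_ofReal]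
  exact integral_nonneg fun x => (hη.mem_Icc x).1

theorem IsRegressionFunction.real_prod_false (hη : IsRegressionFunction Q η) {A : Set E}
    (hA : MeasurableSet A) :
    Q.real (A ×ˢ {false}) = ∫ x in A, (1 - η x) ∂(Q.map Prod.fst) := by
  have h1 : Q.real (A ×ˢ {false}) + Q.real (A ×ˢ {true}) = (Q.map Prod.fst).real A := by
    rw [← measureReal_union, ← Set.prod_union, map_measureReal_apply (by fun_prop) hA]
    · congr 1
      ext ⟨x, b⟩
      cases b <;> simp
    · exact Set.disjoint_prod.2 (Or.inr (by simp))
    · exact hA.prod (measurableSet_singleton _)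
  rw [integral_sub (integrable_const _).integrableOn hη.integrable.integrableOn,
    ← hη.real_prod_true hA]
  simp
  linarith

theorem IsRegressionFunction.integrable_ite (hη : IsRegressionFunction Q η) {g : E → Bool}
    (hg : Measurable g) :
    Integrable (fun x => if g x = true then 1 - η x else η x) (Q.map Prod.fst) := by
  refine Integrable.of_mem_Icc 0 1 (Measurable.aemeasurable ?_) (.of_forall fun x => ?_)
  · exact Measurable.ite (hg (measurableSet_singleton true))
      (measurable_const.sub hη.measurable) hη.measurable
  · have := hη.mem_Icc x
    split_ifs
    · constructor <;> linarith [this.1, this.2]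
    · exact this

theorem IsRegressionFunction.risk_eq_integral (hη : IsRegressionFunction Q η) {g : E → Bool}
    (hg : Measurable g) :
    risk Q g = ∫ x, (if g x = true then 1 - η x else η x) ∂(Q.map Prod.fst) := by
  have hA : MeasurableSet (g ⁻¹' {true}) := hg (measurableSet_singleton _)
  have hset : {p : E × Bool | g p.1 ≠ p.2} =
      (g ⁻¹' {true}) ×ˢ {false} ∪ (g ⁻¹' {true})ᶜ ×ˢ {true} := by
    ext ⟨x, b⟩
    cases b <;> simp
  rw [risk, hset, measureReal_union _ (hA.compl.prod (measurableSet_singleton _)),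
    hη.real_prod_false hA, hη.real_prod_true hA.compl,
    ← integral_add_compl hA (hη.integrable_ite hg)]
  · congr 1
    · exact setIntegral_congr_fun hA fun x hx => by
        have : g x = true := hx
        simp [this]
    · exact setIntegral_congr_fun hA.compl fun x hx => by
        have : g x ≠ true := hx
        simp [this]
  · exact Set.disjoint_prod.2 (Or.inr (by simp))

theorem IsRegressionFunction.risk_bayesClassifier_le (hη : IsRegressionFunction Q η)
    {g : E → Bool} (hg : Measurable g) : risk Q (bayesClassifier η) ≤ risk Q g := by
  rw [hη.risk_eq_integral hη.measurable_bayesClassifier, hη.risk_eq_integral hg]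
  refine integral_mono (hη.integrable_ite hη.measurable_bayesClassifier) (hη.integrable_ite hg)
    fun x => ?_
  simp only [bayesClassifier, decide_eq_true_eq]
  split_ifs <;> linarith

theorem IsRegressionFunction.bayesRisk_eq (hη : IsRegressionFunction Q η) :
    bayesRisk Q = risk Q (bayesClassifier η) := by
  have : Nonempty {g : E → Bool // Measurable g} :=
    ⟨⟨_, hη.measurable_bayesClassifier⟩⟩
  refine le_antisymm (ciInf_le ⟨0, ?_⟩
    (⟨_, hη.measurable_bayesClassifier⟩ : {g : E → Bool // Measurable g})) ?_
  · rintro _ ⟨g, rfl⟩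
    exact measureReal_nonneg
  · exact le_ciInf fun g => hη.risk_bayesClassifier_le g.2

/-- A wrong decision at `x` costs `2|η x - 1/2|` over the Bayes rule. Errors occur only where the
margin is below `t`, so each costs at most `2t`. -/
theorem IsRegressionFunction.risk_sub_le (hη : IsRegressionFunction Q η) {g : E → Bool}
    (hg : Measurable g) {t : ℝ}
    (h : ∀ᵐ x ∂(Q.map Prod.fst), t ≤ |η x - 1 / 2| → g x = bayesClassifier η x) :
    risk Q g - risk Q (bayesClassifier η)
      ≤ 2 * t * (Q.map Prod.fst).real {x | |η x - 1 / 2| < t} := by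
  have hW : MeasurableSet {x | |η x - 1 / 2| < t} :=
    measurableSet_lt (by have := hη.measurable; fun_prop) measurable_const
  rw [hη.risk_eq_integral hη.measurable_bayesClassifier, hη.risk_eq_integral hg,
    ← integral_sub (hη.integrable_ite hg) (hη.integrable_ite hη.measurable_bayesClassifier)]
  have : 2 * t * (Q.map Prod.fst).real {x | |η x - 1 / 2| < t} =
      ∫ x, {x | |η x - 1 / 2| < t}.indicator (fun _ => 2 * t) x ∂(Q.map Prod.fst) := by
    rw [integral_indicator hW, setIntegral_const, smul_eq_mul, mul_comm]
  rw [this]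
  refine integral_mono_ae ((hη.integrable_ite hg).sub
    (hη.integrable_ite hη.measurable_bayesClassifier))
    ((integrable_const _).indicator hW) ?_
  filter_upwards [h] with x hx
  by_cases hxt : t ≤ |η x - 1 / 2|
  · have hn : x ∉ {x | |η x - 1 / 2| < t} := by simpa using hxt
    rw [Set.indicator_of_notMem hn, hx hxt, sub_self]
  · have hm : x ∈ {x | |η x - 1 / 2| < t} := by simpa using hxt
    rw [Set.indicator_of_mem hm]
    have h2 := abs_lt.1 (not_le.1 hxt)
    simp only [bayesClassifier, decide_eq_true_eq]
    split_ifs <;> linarith [h2.1, h2.2]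

theorem real_ne_bayesClassifier_le {g : E → Bool} {t : ℝ}
    (h : ∀ᵐ x ∂(Q.map Prod.fst), t ≤ |η x - 1 / 2| → g x = bayesClassifier η x) :
    (Q.map Prod.fst).real {x | g x ≠ bayesClassifier η x}
      ≤ (Q.map Prod.fst).real {x | |η x - 1 / 2| < t} := by
  refine ENNReal.toReal_mono (measure_ne_top _ _) (measure_mono_ae ?_)
  filter_upwards [h] with x hx hne
  exact not_le.1 fun h' => hne (hx h')

end Risk

/-! ### Passing to represented data -/

section Representation

variable {E Z : Type*} [MeasurableSpace E] [MeasurableSpace Z] {μ : Measure (E × Bool)}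
  {F : E → Z} {η : E → ℝ} {h : Z → ℝ}

theorem map_fst_map (hF : Measurable F) :
    (μ.map fun p => (F p.1, p.2)).map Prod.fst = (μ.map Prod.fst).map F := by
  rw [Measure.map_map (by fun_prop) (by fun_prop), Measure.map_map (by fun_prop) (by fun_prop)]
  rfl

theorem risk_map (hF : Measurable F) {G : Z → Bool} (hG : Measurable G) :
    risk (μ.map fun p => (F p.1, p.2)) G = risk μ (fun x => G (F x)) := by
  rw [risk, risk, map_measureReal_apply (by fun_prop)]
  · rfl
  · exact (measurableSet_eq_fun (hG.comp measurable_fst) measurable_snd).compl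

theorem risk_congr_ae {Q : Measure (E × Bool)} {f g : E → Bool}
    (hfg : ∀ᵐ x ∂(Q.map Prod.fst), f x = g x) : risk Q f = risk Q g := by
  refine measureReal_congr ?_
  filter_upwards [ae_of_ae_map (by fun_prop) hfg] with p hp
  change (f p.1 ≠ p.2) = (g p.1 ≠ p.2)
  rw [hp]

theorem measure_eq_zero_of_integral_le {α : Type*} [MeasurableSpace α] {m : Measure α}
    [IsFiniteMeasure m] {A : Set α} (hA : MeasurableSet A) {f : α → ℝ} (hf : Integrable f m)
    (hneg : ∀ x ∈ A, 0 < f x) (h : ∫ x in A, f x ∂m ≤ 0) : m A = 0 := by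
  have h0 := (setIntegral_eq_zero_iff_of_nonneg_ae (f := f) (s := A)
    (ae_restrict_of_forall_mem hA fun x hx => (hneg x hx).le) hf.integrableOn).1
    (le_antisymm h (setIntegral_nonneg hA fun x hx => (hneg x hx).le))
  have h1 : ∀ᵐ x ∂m, x ∉ A := by
    rw [Filter.EventuallyEq, ae_restrict_iff' hA] at h0
    filter_upwards [h0] with x hx hxA
    exact (hneg x hxA).ne' (hx hxA)
  simpa [ae_iff] using h1

/-- If the Bayes classifier factors through `F`, then it is almost surely the Bayes classifier of
the represented data. -/
theorem bayesClassifier_ae_eq_of_factor [IsProbabilityMeasure μ] (hF : Measurable F) (hη : IsRegressionFunction μ η)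
    (hh : IsRegressionFunction (μ.map fun p => (F p.1, p.2)) h) {g : Z → Bool}
    (hg : Measurable g) (hfac : ∀ x, bayesClassifier η x = g (F x)) :
    ∀ᵐ x ∂(μ.map Prod.fst), bayesClassifier η x = bayesClassifier h (F x) := by
  have hP : IsProbabilityMeasure (μ.map fun p => (F p.1, p.2)) :=
    Measure.isProbabilityMeasure_map (by fun_prop)
  -- `h ∘ F` is the conditional expectation of `η` given `F`.
  have key : ∀ A : Set Z, MeasurableSet A →
      ∫ x in F ⁻¹' A, η x ∂(μ.map Prod.fst) = ∫ x in F ⁻¹' A, h (F x) ∂(μ.map Prod.fst) := by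
    intro A hA
    rw [← hη.real_prod_true (hF hA), ← setIntegral_map hA hh.measurable.aestronglyMeasurable
      hF.aemeasurable, ← map_fst_map hF, ← hh.real_prod_true hA,
      map_measureReal_apply (by fun_prop) (hA.prod (measurableSet_singleton _))]
    rfl
  have hi : Integrable (fun x => h (F x)) (μ.map Prod.fst) :=
    Integrable.of_mem_Icc 0 1 (hh.measurable.comp hF).aemeasurable
      (.of_forall fun x => hh.mem_Icc _)
  -- The rules can disagree in two ways. Each disagreement set is an `F`-preimage on which `η - h ∘
  -- F` has a strict constant sign, yet by `key` its integral there is zero, so the set is null.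
  have hA : MeasurableSet {r : Z | g r = true ∧ h r < 1 / 2} :=
    (hg (measurableSet_singleton true)).inter (measurableSet_lt hh.measurable measurable_const)
  have hB : MeasurableSet {r : Z | g r = false ∧ 1 / 2 ≤ h r} :=
    (hg (measurableSet_singleton false)).inter (measurableSet_le measurable_const hh.measurable)
  have hA0 := measure_eq_zero_of_integral_le (hF hA) (f := fun x => η x - h (F x))
    (m := μ.map Prod.fst) (hη.integrable.sub hi)
    (fun x hx => by
      have h1 : bayesClassifier η x = true := (hfac x).trans hx.1
      have h2 : h (F x) < 1 / 2 := hx.2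
      simp only [bayesClassifier, decide_eq_true_eq] at h1
      linarith)
    (by rw [integral_sub hη.integrable.integrableOn hi.integrableOn, key _ hA, sub_self])
  have hB0 := measure_eq_zero_of_integral_le (hF hB) (f := fun x => h (F x) - η x)
    (m := μ.map Prod.fst) (hi.sub hη.integrable)
    (fun x hx => by
      have h1 : bayesClassifier η x = false := (hfac x).trans hx.1
      have h2 : 1 / 2 ≤ h (F x) := hx.2
      simp only [bayesClassifier, decide_eq_false_iff_not] at h1
      linarith)
    (by rw [integral_sub hi.integrableOn hη.integrable.integrableOn, key _ hB, sub_self])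
  have hA1 : ∀ᵐ x ∂(μ.map Prod.fst), x ∉ F ⁻¹' {r : Z | g r = true ∧ h r < 1 / 2} :=
    measure_eq_zero_iff_ae_notMem.1 hA0
  have hB1 : ∀ᵐ x ∂(μ.map Prod.fst), x ∉ F ⁻¹' {r : Z | g r = false ∧ 1 / 2 ≤ h r} :=
    measure_eq_zero_iff_ae_notMem.1 hB0
  filter_upwards [hA1, hB1] with x hx1 hx2
  rw [hfac]
  simp only [Set.mem_preimage, Set.mem_ofPred_eq, not_and, not_lt, not_le] at hx1 hx2
  rcases hgx : g (F x) with _ | _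
  · simpa [bayesClassifier] using hx2 hgx
  · simpa [bayesClassifier] using hx1 hgx

end Representation

/-! ### Rotation-invariant labelings -/

section Rotation

/-- In dimension at least two, the rotation group acts transitively on every sphere. -/
theorem exists_specialOrthogonal_mulVec_eq {d : ℕ} (hd : 1 < d) {x y : EuclideanSpace ℝ (Fin d)}
    (hxy : ‖x‖ = ‖y‖) :
    ∃ A ∈ Matrix.specialOrthogonalGroup (Fin d) ℝ, WithLp.toLp 2 (A *ᵥ x.ofLp) = y := by
  rcases eq_or_ne x y with rfl | hne
  · exact ⟨1, one_mem _, by simp⟩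
  -- The reflection exchanging `x` and `y` has determinant `-1`. A second reflection along some `z ⊥
  -- y`, available since `d ≥ 2`, fixes `y` and restores determinant `1`.
  obtain ⟨z, hz, hz0⟩ : ∃ z ∈ (Submodule.span ℝ {y})ᗮ, z ≠ 0 := by
    refine Submodule.exists_mem_ne_zero_of_ne_bot fun hbot => ?_
    have h1 := (Submodule.span ℝ {y}).finrank_add_finrank_orthogonal
    have h2 := finrank_span_le_card (R := ℝ) ({y} : Set (EuclideanSpace ℝ (Fin d)))
    rw [hbot, finrank_bot, finrank_euclideanSpace_fin] at h1
    simp at h2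
    omega
  have hdet : ∀ w : EuclideanSpace ℝ (Fin d), w ≠ 0 →
      LinearMap.det ((Submodule.span ℝ {w})ᗮ.reflection).toLinearMap = -1 := by
    intro w hw
    rw [Submodule.det_reflection, Submodule.orthogonal_orthogonal, finrank_span_singleton hw,
      pow_one]
  let φ := (Submodule.span ℝ {x - y})ᗮ.reflection.trans (Submodule.span ℝ {z})ᗮ.reflection
  have hφ : φ x = y := by
    simp only [φ, LinearIsometryEquiv.trans_apply]
    rw [Submodule.reflection_sub hxy]
    refine Submodule.reflection_mem_subspace_eq_self ?_
    rw [Submodule.mem_orthogonal_singleton_iff_inner_left]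
    exact Submodule.mem_orthogonal_singleton_iff_inner_right.1 hz
  let b := EuclideanSpace.basisFun (Fin d) ℝ
  refine ⟨LinearMap.toMatrix b.toBasis b.toBasis φ.toLinearMap,
    Matrix.mem_specialOrthogonalGroup_iff.2 ⟨φ.toMatrix_mem_unitaryGroup b b, ?_⟩, ?_⟩
  · rw [LinearMap.det_toMatrix]
    have : φ.toLinearMap = (Submodule.span ℝ {z})ᗮ.reflection.toLinearMap ∘ₗ
        (Submodule.span ℝ {x - y})ᗮ.reflection.toLinearMap := rfl
    rw [this, LinearMap.det_comp, hdet z hz0, hdet _ (sub_ne_zero.2 hne)]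
    norm_num
  · have h1 := LinearMap.toMatrix_mulVec_repr b.toBasis b.toBasis φ.toLinearMap x
    have h2 : ∀ v : EuclideanSpace ℝ (Fin d), ⇑(b.toBasis.repr v) = v.ofLp := fun v => by
      ext i; simp [b]
    rw [h2, h2] at h1
    rw [h1]
    exact hφ

/-- A rotation-invariant labeling (even, in dimension one) is a function of the norm. -/
theorem SOInvariant.exists_factor {d : ℕ} (hd : d ≠ 0) {f : EuclideanSpace ℝ (Fin d) → Bool}
    (hf : SOInvariant f) (hf1 : d = 1 → ∀ x, f (-x) = f x) (hm : Measurable f) :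
    ∃ g : ℝ → Bool, Measurable g ∧ ∀ x, f x = g ‖x‖ := by
  let e : EuclideanSpace ℝ (Fin d) := EuclideanSpace.single ⟨0, Nat.pos_of_ne_zero hd⟩ 1
  have he : ‖e‖ = 1 := by simp [e]
  refine ⟨fun r => f (r • e), hm.comp (by fun_prop), fun x => ?_⟩
  have hx : ‖‖x‖ • e‖ = ‖x‖ := by simp [norm_smul, he]
  rcases (Nat.one_le_iff_ne_zero.2 hd).eq_or_lt with h1 | h1
  · have h1 := h1.symm
    subst h1
    have hxe : x = x 0 • e := by
      ext i
      fin_cases i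
      simp [e]
    have hnx : ‖x‖ = |x 0| := by
      conv_lhs => rw [hxe]
      rw [norm_smul, he, mul_one, Real.norm_eq_abs]
    conv_lhs => rw [hxe]
    rw [hnx]
    rcases abs_choice (x 0) with h | h
    · rw [h]
    · rw [h]
      dsimp only
      rw [neg_smul, hf1 rfl]
  · obtain ⟨A, hA, hAx⟩ := exists_specialOrthogonal_mulVec_eq h1 hx.symm
    dsimp only
    rw [← hAx, hf A hA]

end Rotation

/-! ### Lower tails of cell counts -/

section LowerTail

variable {α : Type*} [MeasurableSpace α] {P : Measure α} [IsProbabilityMeasure P]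

open Classical in
/-- A Chernoff bound for the lower tail of the binomial distribution. -/
theorem measure_card_filter_lt_le {n k : ℕ} {C : Set α} (hC : MeasurableSet C)
    (hk : 4 * (k : ℝ) ≤ n * P.real C) :
    (Measure.pi fun _ : Fin n => P) {S | (Finset.univ.filter fun i => S i ∈ C).card < k}
      ≤ ENNReal.ofReal (Real.exp (-k)) := by
  let f : α → ℝ := C.indicator 1
  have hf : Measurable f := measurable_one.indicator hC
  let Y : Fin n → (Fin n → α) → ℝ := fun i S => f (S i)
  have hY : ∀ i, Measurable (Y i) := fun i => hf.comp (measurable_pi_apply i)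
  have hind : ProbabilityTheory.iIndepFun Y (Measure.pi fun _ : Fin n => P) :=
    ProbabilityTheory.iIndepFun_pi fun _ => hf.aemeasurable
  have hexp : ∀ x, Real.exp (-1 * f x) = 1 - (1 - Real.exp (-1)) * f x := by
    intro x
    by_cases hx : x ∈ C <;> simp [f, hx]
  have hfint : Integrable f P := (integrable_const 1).indicator hC
  -- At exponent `-1`, `1 - (1 - e⁻¹)p ≤ 1 - p/2 ≤ exp(-p/2)`. The Chernoff bound becomes `exp(k -
  -- np/2)`, which `4k ≤ np` turns into `exp(-k)`.
  have hmgf : ∀ i, ProbabilityTheory.mgf (Y i) (Measure.pi fun _ : Fin n => P) (-1)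
      ≤ Real.exp (-(P.real C / 2)) := by
    intro i
    have h1 : ProbabilityTheory.mgf (Y i) (Measure.pi fun _ : Fin n => P) (-1)
        = ∫ x, Real.exp (-1 * f x) ∂P := by
      have := integral_map (μ := Measure.pi fun _ : Fin n => P)
        (measurable_pi_apply i).aemeasurable
        (f := fun x => Real.exp (-1 * f x)) (by fun_prop)
      rw [(measurePreserving_eval (fun _ : Fin n => P) i).map_eq] at this
      exact this.symm
    rw [h1]
    simp_rw [hexp]
    rw [integral_sub (integrable_const _) (hfint.const_mul _), integral_const_mul,
      integral_indicator_one hC]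
    simp only [integral_const, probReal_univ, smul_eq_mul, mul_one]
    have h2 : Real.exp (-1) ≤ 1 / 2 := by
      have := Real.exp_neg_one_lt_d9
      linarith
    have h3 := Real.add_one_le_exp (-(P.real C / 2))
    nlinarith [measureReal_nonneg (μ := P) (s := C)]
  have hint : Integrable (fun S => Real.exp (-1 * ∑ i, Y i S))
      (Measure.pi fun _ : Fin n => P) := by
    refine Integrable.of_mem_Icc 0 1 (Measurable.aemeasurable (by fun_prop))
      (.of_forall fun S => ⟨(Real.exp_pos _).le, Real.exp_le_one_iff.2 ?_⟩)
    have : 0 ≤ ∑ i, Y i S :=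
      Finset.sum_nonneg fun i _ => Set.indicator_nonneg (fun _ _ => zero_le_one) _
    linarith
  have hsum : ∀ S, ((Finset.univ.filter fun i => S i ∈ C).card : ℝ) = ∑ i, Y i S := by
    intro S
    rw [Finset.card_filter]
    push_cast
    exact Finset.sum_congr rfl fun i _ => by simp [Y, f, Set.indicator_apply]
  have htail := ProbabilityTheory.measure_le_le_exp_mul_mgf
    (μ := Measure.pi fun _ : Fin n => P) (X := fun S => ∑ i, Y i S) (k : ℝ)
    (by norm_num : (-1 : ℝ) ≤ 0) hint
  have hprod : ProbabilityTheory.mgf (fun S => ∑ i, Y i S) (Measure.pi fun _ : Fin n => P) (-1)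
      ≤ Real.exp (-(n * P.real C / 2)) := by
    have h1 := hind.mgf_sum hY (t := -1) Finset.univ
    have h2 : (∑ i, Y i) = fun S => ∑ i, Y i S := by ext S; simp
    rw [h2] at h1
    rw [h1]
    calc _ ≤ ∏ _i : Fin n, Real.exp (-(P.real C / 2)) :=
          Finset.prod_le_prod (fun i _ => ProbabilityTheory.mgf_nonneg) fun i _ => hmgf i
      _ = _ := by
          rw [Finset.prod_const, Finset.card_univ, Fintype.card_fin, ← Real.exp_nat_mul]
          congr 1; ring
  calc (Measure.pi fun _ : Fin n => P) {S | (Finset.univ.filter fun i => S i ∈ C).card < k}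
      ≤ (Measure.pi fun _ : Fin n => P) {S | ∑ i, Y i S ≤ k} := by
        refine measure_mono fun S hS => ?_
        change ∑ i, Y i S ≤ k
        rw [← hsum]
        exact_mod_cast (le_of_lt hS)
    _ = ENNReal.ofReal ((Measure.pi fun _ : Fin n => P).real {S | ∑ i, Y i S ≤ k}) :=
        (ofReal_measureReal).symm
    _ ≤ _ := by
        refine ENNReal.ofReal_le_ofReal (htail.trans ?_)
        calc _ ≤ Real.exp (k : ℝ) * Real.exp (-(n * P.real C / 2)) := by
              rw [neg_neg, one_mul]
              gcongr
          _ ≤ Real.exp (-k) := by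
              rw [← Real.exp_add]
              exact Real.exp_le_exp.2 (by linarith)

open Classical in
/-- Simultaneously over a countable disjoint family, every set of large probability receives at
least `k` sample points. -/
theorem measure_exists_card_filter_lt_le {ι : Type*} [Countable ι] {n k : ℕ} (hk0 : 1 ≤ k)
    {C : ι → Set α} (hC : ∀ j, MeasurableSet (C j)) (hd : Pairwise (Function.onFun Disjoint C)) :
    (Measure.pi fun _ : Fin n => P) {S | ∃ j, 4 * (k : ℝ) ≤ n * P.real (C j) ∧
        (Finset.univ.filter fun i => S i ∈ C j).card < k}
      ≤ ENNReal.ofReal (n * Real.exp (-k)) := by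
  have hk1 : (1 : ℝ) ≤ k := by exact_mod_cast hk0
  -- A heavy cell satisfies `1 ≤ n P(C j)`, so the extra factor is free. The weights `P(C j)` sum to
  -- at most one, which makes the union bound work for infinitely many cells.
  have hcell : ∀ j, (Measure.pi fun _ : Fin n => P) {S | 4 * (k : ℝ) ≤ n * P.real (C j) ∧
        (Finset.univ.filter fun i => S i ∈ C j).card < k}
      ≤ P (C j) * ENNReal.ofReal (n * Real.exp (-k)) := by
    intro j
    by_cases hj : 4 * (k : ℝ) ≤ n * P.real (C j)
    · refine (measure_mono fun S hS => hS.2).trans ((measure_card_filter_lt_le (hC j) hj).trans ?_)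
      rw [← ofReal_measureReal (μ := P), ← ENNReal.ofReal_mul measureReal_nonneg]
      refine ENNReal.ofReal_le_ofReal ?_
      nlinarith [Real.exp_pos (-(k : ℝ))]
    · simp [hj]
  calc _ ≤ (Measure.pi fun _ : Fin n => P) (⋃ j, {S | 4 * (k : ℝ) ≤ n * P.real (C j) ∧
        (Finset.univ.filter fun i => S i ∈ C j).card < k}) :=
        measure_mono (by rintro S ⟨j, hj⟩; exact Set.mem_iUnion.2 ⟨j, hj⟩)
    _ ≤ ∑' j, P (C j) * ENNReal.ofReal (n * Real.exp (-k)) :=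
        (measure_iUnion_le _).trans (ENNReal.tsum_le_tsum hcell)
    _ = P (⋃ j, C j) * ENNReal.ofReal (n * Real.exp (-k)) := by
        rw [ENNReal.tsum_mul_right, measure_iUnion hd hC]
    _ ≤ 1 * ENNReal.ofReal (n * Real.exp (-k)) := by gcongr; exact prob_le_one
    _ = _ := one_mul _

end LowerTail

/-! ### Label fluctuations given the features -/

section Labels

/-- Every law with regression function `h` arises by thresholding an independent uniform
variable. -/
theorem IsRegressionFunction.eq_map_prod {E : Type*} [MeasurableSpace E] {Q : Measure (E × Bool)}
    [IsProbabilityMeasure Q] {h : E → ℝ} (hh : IsRegressionFunction Q h) :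
    Q = ((Q.map Prod.fst).prod (volume.restrict (Set.Icc (0 : ℝ) 1))).map
      fun p => (p.1, decide (p.2 ≤ h p.1)) := by
  have hmeas : Measurable fun p : E × ℝ => (p.1, decide (p.2 ≤ h p.1)) := by
    refine measurable_fst.prodMk (measurable_to_bool ?_)
    have : (fun p : E × ℝ => decide (p.2 ≤ h p.1)) ⁻¹' {true} = {p | p.2 ≤ h p.1} := by
      ext p; simp
    rw [this]
    exact measurableSet_le measurable_snd (hh.measurable.comp measurable_fst)
  have hU : IsProbabilityMeasure (volume.restrict (Set.Icc (0 : ℝ) 1)) := ⟨by simp⟩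
  have hQ' := Measure.isProbabilityMeasure_map hmeas.aemeasurable
    (μ := (Q.map Prod.fst).prod (volume.restrict (Set.Icc (0 : ℝ) 1)))
  have htrue : ∀ A, MeasurableSet A → Q (A ×ˢ {true}) = ((Q.map Prod.fst).prod
      (volume.restrict (Set.Icc (0 : ℝ) 1))).map (fun p => (p.1, decide (p.2 ≤ h p.1)))
        (A ×ˢ {true}) := by
    intro A hA
    rw [hh.apply_eq A hA, Measure.map_apply hmeas (hA.prod (measurableSet_singleton _)),
      Measure.prod_apply (hmeas (hA.prod (measurableSet_singleton _))), ← lintegral_indicator hA]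
    refine lintegral_congr fun x => ?_
    by_cases hx : x ∈ A
    · have : Prod.mk x ⁻¹' ((fun p : E × ℝ => (p.1, decide (p.2 ≤ h p.1))) ⁻¹'
          (A ×ˢ {true})) = Set.Iic (h x) := by
        ext u; simp [hx]
      rw [this, Set.indicator_of_mem hx, Measure.restrict_apply measurableSet_Iic]
      have h2 : Set.Iic (h x) ∩ Set.Icc (0 : ℝ) 1 = Set.Icc 0 (h x) := by
        ext u
        simp only [Set.mem_inter_iff, Set.mem_Iic, Set.mem_Icc]
        have := (hh.mem_Icc x).2
        constructor
        · rintro ⟨h1, h2, -⟩; exact ⟨h2, h1⟩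
        · rintro ⟨h1, h2⟩; exact ⟨h2, h1, h2.trans this⟩
      rw [h2, Real.volume_Icc, sub_zero]
    · have : Prod.mk x ⁻¹' ((fun p : E × ℝ => (p.1, decide (p.2 ≤ h p.1))) ⁻¹'
          (A ×ˢ {true})) = ∅ := by
        ext u; simp [hx]
      rw [this, Set.indicator_of_notMem hx, measure_empty]
  have huniv : ∀ A, MeasurableSet A → Q (A ×ˢ Set.univ) = ((Q.map Prod.fst).prod
      (volume.restrict (Set.Icc (0 : ℝ) 1))).map (fun p => (p.1, decide (p.2 ≤ h p.1)))
        (A ×ˢ Set.univ) := by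
    intro A hA
    rw [Measure.map_apply hmeas (hA.prod .univ)]
    have : (fun p : E × ℝ => (p.1, decide (p.2 ≤ h p.1))) ⁻¹' (A ×ˢ Set.univ)
        = A ×ˢ Set.univ := by
      ext p
      simp only [Set.mem_preimage, Set.mem_prod, Set.mem_univ]
    rw [this, Measure.prod_prod, measure_univ, mul_one, Measure.map_apply measurable_fst hA,
      Set.prod_univ]
  have hfalse : ∀ R : Measure (E × Bool), IsProbabilityMeasure R → ∀ A, MeasurableSet A →
      R (A ×ˢ {false}) = R (A ×ˢ Set.univ) - R (A ×ˢ {true}) := by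
    intro R _ A hA
    rw [← measure_sdiff (Set.prod_mono_right (Set.subset_univ _))
      (hA.prod (measurableSet_singleton _)).nullMeasurableSet (measure_ne_top _ _)]
    congr 1
    ext ⟨x, b⟩
    cases b <;> simp
  refine Measure.ext_prod fun {A t} hA ht => ?_
  have hcases : t = ∅ ∨ t = {true} ∨ t = {false} ∨ t = Set.univ := by
    by_cases h1 : true ∈ t <;> by_cases h2 : false ∈ t
    · exact Or.inr (Or.inr (Or.inr (Set.eq_univ_of_forall fun b => by cases b <;> assumption)))
    · exact Or.inr (Or.inl (by ext b; cases b <;> simp [h1, h2]))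
    · exact Or.inr (Or.inr (Or.inl (by ext b; cases b <;> simp [h1, h2])))
    · exact Or.inl (by ext b; cases b <;> simp [h1, h2])
  rcases hcases with rfl | rfl | rfl | rfl
  · simp
  · exact htrue A hA
  · rw [hfalse Q inferInstance A hA, hfalse _ hQ' A hA, htrue A hA, huniv A hA]
  · exact huniv A hA

instance isProbabilityMeasure_restrict_unitInterval :
    IsProbabilityMeasure ((volume : Measure ℝ).restrict (Set.Icc 0 1)) := ⟨by simp⟩

/-- Bounds that hold conditionally on the features hold for the sample. -/
theorem IsRegressionFunction.measure_pi_le_of_forall {E : Type*} [MeasurableSpace E]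
    {Q : Measure (E × Bool)} [IsProbabilityMeasure Q] {h : E → ℝ} (hh : IsRegressionFunction Q h)
    {n : ℕ} {B : Set (Fin n → E × Bool)} (hB : MeasurableSet B) {c : ℝ≥0∞}
    (hc : ∀ x : Fin n → E, (Measure.pi fun _ : Fin n => (volume : Measure ℝ).restrict
      (Set.Icc 0 1)) {u | (fun i => (x i, decide (u i ≤ h (x i)))) ∈ B} ≤ c) :
    (Measure.pi fun _ : Fin n => Q) B ≤ c := by
  let U := (volume : Measure ℝ).restrict (Set.Icc 0 1)
  let ψ : E × ℝ → E × Bool := fun p => (p.1, decide (p.2 ≤ h p.1))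
  have hψ : Measurable ψ := by
    refine measurable_fst.prodMk (measurable_to_bool ?_)
    have : (fun p : E × ℝ => decide (p.2 ≤ h p.1)) ⁻¹' {true} = {p | p.2 ≤ h p.1} := by
      ext p; simp
    rw [this]
    exact measurableSet_le measurable_snd (hh.measurable.comp measurable_fst)
  have hQ : Q = ((Q.map Prod.fst).prod U).map ψ := hh.eq_map_prod
  have hψn : Measurable fun (w : Fin n → E × ℝ) i => ψ (w i) := by fun_prop
  have hpi : (Measure.pi fun _ : Fin n => Q)
      = (Measure.pi fun _ : Fin n => (Q.map Prod.fst).prod U).map fun w i => ψ (w i) := by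
    have hQ' : IsProbabilityMeasure (((Q.map Prod.fst).prod U).map ψ) :=
      Measure.isProbabilityMeasure_map hψ.aemeasurable
    rw [Measure.pi_map_pi fun _ => hψ.aemeasurable]
    congr 1
    funext _
    exact hQ
  -- Regrouping `n` pairs as a pair of `n`-tuples lets Tonelli freeze all features and integrate
  -- over the uniform variables alone.
  have hmp := (measurePreserving_arrowProdEquivProdArrow E ℝ (Fin n)
    (fun _ => Q.map Prod.fst) (fun _ => U)).symm
  have hmeas : MeasurableSet ((MeasurableEquiv.arrowProdEquivProdArrow E ℝ (Fin n)).symm ⁻¹'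
      ((fun (w : Fin n → E × ℝ) i => ψ (w i)) ⁻¹' B)) :=
    (MeasurableEquiv.arrowProdEquivProdArrow E ℝ (Fin n)).symm.measurable (hψn hB)
  rw [hpi, Measure.map_apply hψn hB, ← hmp.map_eq,
    Measure.map_apply hmp.measurable (hψn hB), Measure.prod_apply hmeas]
  calc _ ≤ ∫⁻ _x, c ∂(Measure.pi fun _ : Fin n => Q.map Prod.fst) :=
        lintegral_mono fun x => hc x
    _ = c := by simp

/-- Hoeffding's inequality for thresholded uniform variables. -/
theorem measure_abs_sum_decide_sub_ge_le {n : ℕ} {p : Fin n → ℝ}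
    (hp : ∀ i, p i ∈ Set.Icc (0 : ℝ) 1) {A : Finset (Fin n)} (hA : A.Nonempty) {t : ℝ}
    (ht : 0 ≤ t) :
    (Measure.pi fun _ : Fin n => (volume : Measure ℝ).restrict (Set.Icc 0 1))
      {u | √(A.card * t) ≤ |∑ i ∈ A, ((if decide (u i ≤ p i) = true then 1 else 0) - p i)|}
      ≤ ENNReal.ofReal (2 * Real.exp (-(2 * t))) := by
  let U := (volume : Measure ℝ).restrict (Set.Icc 0 1)
  let f : Fin n → ℝ → ℝ := fun i u => (Set.Iic (p i)).indicator 1 u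
  have hf : ∀ i, Measurable (f i) := fun i => measurable_one.indicator measurableSet_Iic
  have hmean : ∀ i, ∫ u, f i u ∂U = p i := by
    intro i
    rw [integral_indicator_one measurableSet_Iic, measureReal_restrict_apply measurableSet_Iic]
    have h2 : Set.Iic (p i) ∩ Set.Icc (0 : ℝ) 1 = Set.Icc 0 (p i) := by
      ext u
      simp only [Set.mem_inter_iff, Set.mem_Iic, Set.mem_Icc]
      have := (hp i).2
      constructor
      · rintro ⟨h1, h2, -⟩; exact ⟨h2, h1⟩
      · rintro ⟨h1, h2⟩; exact ⟨h2, h1, h2.trans this⟩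
    rw [h2, Real.volume_real_Icc_of_le (hp i).1, sub_zero]
  have hsub : ∀ i, ProbabilityTheory.HasSubgaussianMGF (fun u => f i u - p i)
      ((‖(1 : ℝ) - 0‖₊ / 2) ^ 2) U := by
    intro i
    have := ProbabilityTheory.hasSubgaussianMGF_of_mem_Icc (μ := U) (X := f i) (a := 0) (b := 1)
      (hf i).aemeasurable (.of_forall fun u => by
        by_cases hu : u ≤ p i <;> simp [f, Set.indicator_apply, hu])
    rwa [hmean i] at this
  have hsub' : ∀ i, ProbabilityTheory.HasSubgaussianMGF (fun u : Fin n → ℝ => f i (u i) - p i)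
      ((‖(1 : ℝ) - 0‖₊ / 2) ^ 2) (Measure.pi fun _ : Fin n => U) := by
    intro i
    have h1 := hsub i
    rw [← (measurePreserving_eval (fun _ : Fin n => U) i).map_eq] at h1
    exact ProbabilityTheory.HasSubgaussianMGF.of_map (μ := Measure.pi fun _ : Fin n => U)
      (X := fun u => f i u - p i) (Y := Function.eval i)
      (measurable_pi_apply i).aemeasurable h1
  have hind : ProbabilityTheory.iIndepFun (fun i (u : Fin n → ℝ) => f i (u i) - p i)
      (Measure.pi fun _ : Fin n => U) :=
    ProbabilityTheory.iIndepFun_pi (X := fun i u => f i u - p i)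
      fun i => ((hf i).sub_const _).aemeasurable
  have hneg : ProbabilityTheory.iIndepFun (fun i (u : Fin n → ℝ) => -(f i (u i) - p i))
      (Measure.pi fun _ : Fin n => U) :=
    ProbabilityTheory.iIndepFun_pi (X := fun i u => -(f i u - p i))
      fun i => ((hf i).sub_const _).neg.aemeasurable
  have hN : (0 : ℝ) < A.card := by exact_mod_cast hA.card_pos
  -- Each centred indicator is sub-Gaussian with parameter `1/4`, hence the exponent `|A|t /
  -- (2|A|/4) = 2t`.
  have hexp : -√(A.card * t) ^ 2 / (2 * ((∑ _i ∈ A, (‖(1 : ℝ) - 0‖₊ / 2) ^ 2 : NNReal) : ℝ))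
      = -(2 * t) := by
    rw [Real.sq_sqrt (by positivity)]
    simp
    field_simp
  have h1 := ProbabilityTheory.HasSubgaussianMGF.measure_sum_ge_le_of_iIndepFun hind
    (s := A) (fun i _ => hsub' i) (Real.sqrt_nonneg (A.card * t))
  have h2 := ProbabilityTheory.HasSubgaussianMGF.measure_sum_ge_le_of_iIndepFun hneg
    (s := A) (fun i _ => (hsub' i).neg) (Real.sqrt_nonneg (A.card * t))
  rw [hexp] at h1 h2
  have hfe : ∀ i u, f i u = if decide (u ≤ p i) = true then 1 else 0 := by
    intro i u
    simp [f, Set.indicator_apply]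
  rw [← ofReal_measureReal]
  refine ENNReal.ofReal_le_ofReal ?_
  calc _ ≤ (Measure.pi fun _ : Fin n => U).real
        ({u | √(A.card * t) ≤ ∑ i ∈ A, (f i (u i) - p i)} ∪
          {u | √(A.card * t) ≤ ∑ i ∈ A, -(f i (u i) - p i)}) := by
        refine measureReal_mono fun u hu => ?_
        change √(A.card * t) ≤ |_| at hu
        simp only [Set.mem_union, Set.mem_ofPred_eq, hfe, Finset.sum_neg_distrib]
        exact le_abs.1 hu
    _ ≤ _ := (measureReal_union_le _ _).trans (by linarith)

open Classical in
/-- With high probability, the label sums over all sets of sample points that lie between two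
sample points are close to their conditional means. -/
theorem IsRegressionFunction.measure_exists_label_deviation_le {Q : Measure (ℝ × Bool)}
    [IsProbabilityMeasure Q] {h : ℝ → ℝ} (hh : IsRegressionFunction Q h) {n : ℕ} {t : ℝ}
    (ht : 0 ≤ t) :
    (Measure.pi fun _ : Fin n => Q) {S | ∃ i j,
        let A := Finset.univ.filter fun l => (S i).1 ≤ (S l).1 ∧ (S l).1 ≤ (S j).1
        A.Nonempty ∧ √(A.card * t) ≤
          |∑ l ∈ A, ((if (S l).2 = true then 1 else 0) - h (S l).1)|}
      ≤ ENNReal.ofReal (n ^ 2 * (2 * Real.exp (-(2 * t)))) := by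
  have hhm := hh.measurable
  refine hh.measure_pi_le_of_forall ?_ fun x => ?_
  · simp only [Set.ofPred_exists]
    refine MeasurableSet.iUnion fun i => MeasurableSet.iUnion fun j => ?_
    have hcond : ∀ l, MeasurableSet {S : Fin n → ℝ × Bool |
        (S i).1 ≤ (S l).1 ∧ (S l).1 ≤ (S j).1} := fun l => by
      rw [Set.ofPred_and]
      exact (measurableSet_le (by fun_prop) (by fun_prop)).inter
        (measurableSet_le (by fun_prop) (by fun_prop))
    have hlab : ∀ l, MeasurableSet {S : Fin n → ℝ × Bool | (S l).2 = true} := fun l =>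
      (measurable_snd.comp (measurable_pi_apply l)) (measurableSet_singleton true)
    have hcard : Measurable fun S : Fin n → ℝ × Bool => (((Finset.univ.filter fun l =>
        (S i).1 ≤ (S l).1 ∧ (S l).1 ≤ (S j).1).card : ℕ) : ℝ) := by
      simp only [Finset.card_filter]
      push_cast
      exact Finset.measurable_sum _ fun l _ =>
        Measurable.ite (hcond l) measurable_const measurable_const
    have hsum : Measurable fun S : Fin n → ℝ × Bool => ∑ l ∈ Finset.univ.filter fun l =>
        (S i).1 ≤ (S l).1 ∧ (S l).1 ≤ (S j).1,
        ((if (S l).2 = true then (1 : ℝ) else 0) - h (S l).1) := by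
      simp only [Finset.sum_filter]
      exact Finset.measurable_sum _ fun l _ => Measurable.ite (hcond l)
        ((Measurable.ite (hlab l) measurable_const measurable_const).sub (by fun_prop))
        measurable_const
    have hne : {S : Fin n → ℝ × Bool | (Finset.univ.filter fun l =>
        (S i).1 ≤ (S l).1 ∧ (S l).1 ≤ (S j).1).Nonempty} = {S | (0 : ℝ) < (((Finset.univ.filter
          fun l => (S i).1 ≤ (S l).1 ∧ (S l).1 ≤ (S j).1).card : ℕ) : ℝ)} := by
      ext S
      simp only [Set.mem_ofPred_eq, Nat.cast_pos, Finset.card_pos]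
    rw [Set.ofPred_and]
    refine MeasurableSet.inter ?_ (measurableSet_le ?_ ?_)
    · rw [hne]
      exact measurableSet_lt measurable_const hcard
    · exact (hcard.mul_const t).sqrt
    · exact hsum.abs
  -- With the features frozen, these at most `n²` index sets are deterministic, so Hoeffding applies
  -- to each and a union bound suffices.
  · let D : Fin n × Fin n → Finset (Fin n) := fun q =>
      Finset.univ.filter fun l => x q.1 ≤ x l ∧ x l ≤ x q.2
    let V : Fin n × Fin n → Set (Fin n → ℝ) := fun q => {u | (D q).Nonempty ∧
      √((D q).card * t) ≤
        |∑ l ∈ D q, ((if decide (u l ≤ h (x l)) = true then 1 else 0) - h (x l))|}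
    calc _ ≤ (Measure.pi fun _ : Fin n => (volume : Measure ℝ).restrict (Set.Icc 0 1))
          (⋃ q ∈ (Finset.univ : Finset (Fin n × Fin n)), V q) := by
          refine measure_mono ?_
          rintro u ⟨i, j, hu⟩
          exact Set.mem_biUnion (Finset.mem_coe.2 (Finset.mem_univ (i, j))) hu
      _ ≤ ∑ q : Fin n × Fin n, ENNReal.ofReal (2 * Real.exp (-(2 * t))) := by
          refine (measure_biUnion_finset_le _ _).trans (Finset.sum_le_sum fun q _ => ?_)
          by_cases hq : (D q).Nonempty
          · exact (measure_mono fun u hu => hu.2).trans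
              (measure_abs_sum_decide_sub_ge_le (fun i => hh.mem_Icc _) hq ht)
          · simp [V, hq]
      _ = _ := by
          rw [Finset.sum_const, Finset.card_univ, Fintype.card_prod, Fintype.card_fin,
            ← ENNReal.ofReal_nsmul, nsmul_eq_mul]
          push_cast
          rw [← sq]

end Labels

/-! ### Nearest-neighbour sets with ties -/

section KNNSet

variable {Z ι : Type*} [PseudoMetricSpace Z] [Fintype ι] {k : ℕ} {pts : ι → Z} {z : Z}

open Classical in
theorem mem_knnSet {i : ι} : i ∈ knnSet k pts z ↔
    (Finset.univ.filter fun j => dist (pts j) z < dist (pts i) z).card < k := by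
  simp [knnSet]

theorem mem_knnSet_of_dist_le {i j : ι} (hi : i ∈ knnSet k pts z)
    (hij : dist (pts j) z ≤ dist (pts i) z) : j ∈ knnSet k pts z := by
  classical
  rw [mem_knnSet] at hi ⊢
  refine lt_of_le_of_lt (Finset.card_le_card ?_) hi
  exact Finset.monotone_filter_right _ fun l _ hl => hl.trans_le hij

/-- A closest excluded point has at least `k` points strictly closer to `z`, and all of these are
included by minimality. -/
theorem le_card_knnSet (hk : k ≤ Fintype.card ι) : k ≤ (knnSet k pts z).card := by
  classical
  by_contra! hlt
  have hne : ((knnSet k pts z)ᶜ).Nonempty := by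
    rw [← Finset.card_pos, Finset.card_compl]
    omega
  obtain ⟨i, hi, hmin⟩ := Finset.exists_min_image _ (fun i => dist (pts i) z) hne
  rw [Finset.mem_compl] at hi
  have h1 := hi
  rw [mem_knnSet, not_lt] at h1
  refine absurd (h1.trans (Finset.card_le_card fun j hj => ?_)) (not_le.2 hlt)
  by_contra hj'
  exact absurd (hmin j (Finset.mem_compl.2 hj')) (not_le.2 (Finset.mem_filter.1 hj).2)

open Classical in
theorem dist_le_of_mem_knnSet {R : ℝ}
    (hk : k ≤ (Finset.univ.filter fun j => dist (pts j) z ≤ R).card) {i : ι}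
    (hi : i ∈ knnSet k pts z) : dist (pts i) z ≤ R := by
  by_contra! hlt
  rw [mem_knnSet] at hi
  refine absurd (hk.trans (Finset.card_le_card ?_)) (not_le.2 hi)
  exact Finset.monotone_filter_right _ fun l _ hl => lt_of_le_of_lt hl hlt

/-- The vote depends on `z` only through the finitely many comparisons between distances. -/
theorem measurable_knnClassifier [MeasurableSpace Z] [OpensMeasurableSpace Z] (k : ℕ)
    (pts : ι → Z) (labels : ι → Bool) : Measurable (knnClassifier k pts labels) := by
  classical
  let c : Z → (ι → ι → Bool) := fun z i j => decide (dist (pts j) z < dist (pts i) z)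
  have hc : Measurable c := by
    refine measurable_pi_lambda _ fun i => measurable_pi_lambda _ fun j => measurable_to_bool ?_
    have : (fun z => c z i j) ⁻¹' {true} = {z | dist (pts j) z < dist (pts i) z} := by
      ext z; simp [c]
    rw [this]
    exact (isOpen_lt (by fun_prop) (by fun_prop)).measurableSet
  let s : (ι → ι → Bool) → Finset ι := fun b =>
    Finset.univ.filter fun i => (Finset.univ.filter fun j => b i j = true).card < k
  have hs : ∀ z, knnSet k pts z = s (c z) := fun z => by
    ext i
    simp [mem_knnSet, s, c]
  have : knnClassifier k pts labels = (fun b => decide ((s b).card ≤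
      2 * ((s b).filter fun i => labels i = true).card)) ∘ c := by
    ext z
    simp only [knnClassifier, hs, Function.comp_apply]
  rw [this]
  exact Measurable.of_discrete.comp hc

end KNNSet

/-! ### Deterministic correctness of the vote -/

section Vote

open Classical in
/-- On the line, the `k`-nearest-neighbour vote recovers the Bayes rule at a point `z` with margin
`τ` when the ball of radius `R` around `z` has at least `k` clean points, corrupted points are
`2R`-separated, label sums over order intervals of clean points are close to their means, and `h`
varies little on the ball. -/
theorem knnClassifier_eq_bayesClassifier {n m k : ℕ} {a : Fin n → ℝ} {b : Fin m → ℝ}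
    {la : Fin n → Bool} {lb : Fin m → Bool} {h : ℝ → ℝ} {z R t τ ε : ℝ} (hk2 : 2 ≤ k)
    (hk : k ≤ (Finset.univ.filter fun l => dist (a l) z ≤ R).card)
    (hb : ∀ i j, i ≠ j → 2 * R < dist (b i) (b j))
    (hdev : ∀ i j, let A := Finset.univ.filter fun l => a i ≤ a l ∧ a l ≤ a j
      A.Nonempty →
        |∑ l ∈ A, ((if la l = true then 1 else 0) - h (a l))| < √(A.card * t))
    (hvar : ∀ l, dist (a l) z ≤ R → |h (a l) - h z| ≤ ε)
    (hgap : ∀ N : ℕ, k ≤ N + 1 → √(N * t) + 1 ≤ N * (τ - ε))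
    (hτ : τ ≤ |h z - 1 / 2|) :
    knnClassifier k (Sum.elim a b) (Sum.elim la lb) z = bayesClassifier h z := by
  set K := knnSet k (Sum.elim a b) z with hK
  have hkn : k ≤ (Finset.univ.filter fun j => dist (Sum.elim a b j) z ≤ R).card := by
    rw [← Finset.card_toLeft_add_card_toRight]
    refine hk.trans (le_trans (Finset.card_le_card fun l hl => ?_) (Nat.le_add_right _ _))
    simpa using hl
  have hR : ∀ i ∈ K, dist (Sum.elim a b i) z ≤ R := fun i hi => dist_le_of_mem_knnSet hkn hi
  have hcard : k ≤ K.card := le_card_knnSet (hkn.trans (Finset.card_le_univ _))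
  have hsplit := K.card_toLeft_add_card_toRight
  have hfsplit := (K.filter fun i => Sum.elim la lb i = true).card_toLeft_add_card_toRight
  have hfl : (K.filter fun i => Sum.elim la lb i = true).toLeft
      = K.toLeft.filter fun l => la l = true := by
    ext l; simp
  have hfr : (K.filter fun i => Sum.elim la lb i = true).toRight
      = K.toRight.filter fun l => lb l = true := by
    ext l; simp
  rw [hfl, hfr] at hfsplit
  have hfB := Finset.card_filter_le K.toRight fun l => lb l = true
  have hB : K.toRight.card ≤ 1 := by
    refine Finset.card_le_one.2 fun i hi j hj => ?_
    by_contra hij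
    have h1 := hR _ (Finset.mem_toRight.1 hi)
    have h2 := hR _ (Finset.mem_toRight.1 hj)
    simp only [Sum.elim_inr] at h1 h2
    have h3 := dist_triangle_right (b i) (b j) z
    linarith [hb i j hij]
  have hAne : K.toLeft.Nonempty := by
    rw [← Finset.card_pos]; omega
  obtain ⟨i₀, hi₀, hmin⟩ := Finset.exists_min_image _ a hAne
  obtain ⟨j₀, hj₀, hmax⟩ := Finset.exists_max_image _ a hAne
  -- This is where dimension one enters: a point between two neighbours is no farther from `z` than
  -- one of them, hence itself a neighbour. So the clean neighbours are an order interval, to which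
  -- `hdev` applies.
  have hA : (Finset.univ.filter fun l => a i₀ ≤ a l ∧ a l ≤ a j₀) = K.toLeft := by
    ext l
    simp only [Finset.mem_filter, Finset.mem_univ, true_and]
    refine ⟨fun ⟨h1, h2⟩ => ?_, fun hl => ⟨hmin l hl, hmax l hl⟩⟩
    rw [Finset.mem_toLeft] at hi₀ hj₀ ⊢
    have hd : dist (a l) z ≤ max (dist (a i₀) z) (dist (a j₀) z) := by
      simp only [Real.dist_eq]
      exact abs_le_max_abs_abs (by linarith) (by linarith)
    rcases le_max_iff.1 hd with hd | hd
    · exact mem_knnSet_of_dist_le hi₀ hd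
    · exact mem_knnSet_of_dist_le hj₀ hd
  have hD := hdev i₀ j₀
  simp only [hA] at hD
  replace hD := hD hAne
  set N := K.toLeft.card with hN
  have hG := hgap N (by omega)
  have hsum : ∑ l ∈ K.toLeft, ((if la l = true then (1 : ℝ) else 0) - h (a l)) =
      (K.toLeft.filter fun l => la l = true).card - ∑ l ∈ K.toLeft, h (a l) := by
    rw [Finset.sum_sub_distrib, Finset.sum_boole]
  rw [hsum] at hD
  have hmean : |∑ l ∈ K.toLeft, h (a l) - N * h z| ≤ N * ε := by
    have : ∑ l ∈ K.toLeft, h (a l) - N * h z = ∑ l ∈ K.toLeft, (h (a l) - h z) := by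
      rw [Finset.sum_sub_distrib, Finset.sum_const, nsmul_eq_mul]
    rw [this]
    refine (Finset.abs_sum_le_sum_abs _ _).trans ((Finset.sum_le_sum fun l hl =>
      hvar l (hR _ (Finset.mem_toLeft.1 hl))).trans ?_)
    rw [Finset.sum_const, nsmul_eq_mul]
  set T := (K.toLeft.filter fun l => la l = true).card with hT
  have hN0 : (0 : ℝ) ≤ N := Nat.cast_nonneg _
  rw [abs_lt] at hD
  rw [abs_le] at hmean
  rw [knnClassifier, ← hK, bayesClassifier, decide_eq_decide]
  -- The `+ 1` in `hgap` puts the clean count `T` at least one vote beyond `N / 2`, on the correct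
  -- side; this absorbs the possible corrupted vote.
  rcases le_abs.1 hτ with hz | hz
  · have h1 : (N : ℝ) + 2 ≤ 2 * T := by nlinarith [hD.1, hmean.1]
    have h2 : N + 2 ≤ 2 * T := by exact_mod_cast h1
    have h3 : 1 / 2 ≤ h z := by
      by_contra! hlt
      nlinarith [hD.1, hmean.1, Real.sqrt_nonneg (N * t), hmean.2]
    simp only [h3, iff_true]
    omega
  · have h1 : 2 * (T : ℝ) + 2 < N := by nlinarith [hD.2, hmean.2]
    have h2 : 2 * T + 2 < N := by exact_mod_cast h1
    have h3 : ¬ 1 / 2 ≤ h z := by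
      intro hle
      nlinarith [hD.1, hmean.1, Real.sqrt_nonneg (N * t), hmean.2]
    simp only [h3, iff_false, not_le]
    omega

end Vote

/-! ### Good samples on the line -/

section Line

variable {Q : Measure (ℝ × Bool)} {X : Set ℝ} {h : ℝ → ℝ} {ω r₀ p₀ Cρ ρ Cβ β : ℝ}

theorem RegularData.ae_mem {E : Type*} [PseudoMetricSpace E] [MeasureSpace E]
    {Q : Measure (E × Bool)} {X : Set E} {h : E → ℝ}
    (hQ : RegularData Q X h ω r₀ p₀ Cρ ρ Cβ β) : ∀ᵐ x ∂(Q.map Prod.fst), x ∈ X := by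
  obtain ⟨p, -, hpQ, -⟩ := hQ.density_bounded_below
  rw [hpQ]
  exact (withDensity_absolutelyContinuous _ _).ae_le (ae_restrict_mem hQ.measurableSet)

theorem RegularData.mul_le_measureReal_closedBall [IsProbabilityMeasure Q]
    (hQ : RegularData Q X h ω r₀ p₀ Cρ ρ Cβ β) (hω : 0 < ω) (hp₀ : 0 < p₀) {z s : ℝ} (hz : z ∈ X)
    (hs : 0 < s) (hsr : s < r₀) :
    p₀ * ω * (2 * s) ≤ (Q.map Prod.fst).real (Metric.closedBall z s) := by
  obtain ⟨p, -, hpQ, hp⟩ := hQ.density_bounded_below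
  refine (ENNReal.ofReal_le_iff_le_toReal (measure_ne_top _ _)).1 ?_
  have hB : MeasurableSet (Metric.closedBall z s) := Metric.isClosed_closedBall.measurableSet
  calc ENNReal.ofReal (p₀ * ω * (2 * s))
      = ENNReal.ofReal p₀ * (ENNReal.ofReal ω * volume (Metric.closedBall z s)) := by
        rw [Real.volume_closedBall, ← ENNReal.ofReal_mul hω.le, ← ENNReal.ofReal_mul hp₀.le,
          mul_assoc]
    _ ≤ ENNReal.ofReal p₀ * volume (X ∩ Metric.closedBall z s) := by
        gcongr
        exact hQ.support_regular z hz s hs hsr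
    _ = ∫⁻ _ in X ∩ Metric.closedBall z s, ENNReal.ofReal p₀ := by simp
    _ ≤ ∫⁻ x in X ∩ Metric.closedBall z s, p x :=
        setLIntegral_mono' (hQ.measurableSet.inter hB) fun x hx => hp x hx.1
    _ = (Q.map Prod.fst) (Metric.closedBall z s) := by
        rw [hpQ, withDensity_apply _ hB, Measure.restrict_restrict hB, Set.inter_comm]

/-- Near every point of the support, some cell of the grid of mesh `3s` has mass of order `s`. -/
theorem RegularData.exists_heavy_cell [IsProbabilityMeasure Q]
    (hQ : RegularData Q X h ω r₀ p₀ Cρ ρ Cβ β) (hω : 0 < ω) (hp₀ : 0 < p₀) {z s : ℝ} (hz : z ∈ X)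
    (hs : 0 < s) (hsr : s < r₀) :
    ∃ j : ℤ, p₀ * ω * s ≤ Q.real {p | ⌊p.1 / (3 * s)⌋ = j} ∧
      ∀ y : ℝ, ⌊y / (3 * s)⌋ = j → dist y z ≤ 4 * s := by
  have hmass := hQ.mul_le_measureReal_closedBall hω hp₀ hz hs hsr
  have h3 : (0 : ℝ) < 3 * s := by positivity
  rw [map_measureReal_apply measurable_fst Metric.isClosed_closedBall.measurableSet] at hmass
  have hnear : ∀ w y : ℝ, |w - z| ≤ s → ⌊y / (3 * s)⌋ = ⌊w / (3 * s)⌋ → dist y z ≤ 4 * s := by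
    intro w y hw hy
    have h1 := Int.abs_sub_lt_one_of_floor_eq_floor hy
    rw [← sub_div, abs_div, abs_of_pos h3, div_lt_one h3] at h1
    rw [Real.dist_eq]
    have := abs_sub_le y w z
    linarith
  -- The ball has length `2s < 3s`, so it meets at most two cells, those of its endpoints, and one
  -- of them carries half its mass. A fixed grid, unlike the balls themselves, gives a disjoint
  -- countable family that serves all `z` at once.
  have hcover : Prod.fst ⁻¹' Metric.closedBall z s ⊆
      {p : ℝ × Bool | ⌊p.1 / (3 * s)⌋ = ⌊(z - s) / (3 * s)⌋} ∪
        {p : ℝ × Bool | ⌊p.1 / (3 * s)⌋ = ⌊(z + s) / (3 * s)⌋} := by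
    intro p hp
    have hp' : |p.1 - z| ≤ s := by simpa [Real.dist_eq] using hp
    rw [abs_le] at hp'
    have h1 : ⌊(z - s) / (3 * s)⌋ ≤ ⌊p.1 / (3 * s)⌋ := Int.floor_le_floor (by gcongr; linarith)
    have h2 : ⌊p.1 / (3 * s)⌋ ≤ ⌊(z + s) / (3 * s)⌋ := Int.floor_le_floor (by gcongr; linarith)
    have h4 : ⌊(z + s) / (3 * s)⌋ ≤ ⌊(z - s) / (3 * s)⌋ + 1 := by
      rw [← Int.floor_add_one]
      refine Int.floor_le_floor ?_
      rw [div_add_one h3.ne']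
      exact (div_le_div_iff_of_pos_right h3).2 (by linarith)
    change ⌊p.1 / (3 * s)⌋ = _ ∨ ⌊p.1 / (3 * s)⌋ = _
    omega
  have hsum := hmass.trans ((measureReal_mono hcover).trans (measureReal_union_le _ _))
  rcases le_total (p₀ * ω * s) (Q.real {p : ℝ × Bool | ⌊p.1 / (3 * s)⌋ = ⌊(z - s) / (3 * s)⌋})
    with hc | hc
  · exact ⟨_, hc, fun y => hnear (z - s) y (by simp [abs_of_pos hs])⟩
  · exact ⟨_, by linarith, fun y => hnear (z + s) y (by simp [abs_of_pos hs])⟩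

open Classical in
/-- The properties of the uncorrupted sample that make the `k`-nearest-neighbour rule succeed
whatever the corrupted examples are. -/
structure IsGoodSample (X : Set ℝ) (h : ℝ → ℝ) (r₀ c L : ℝ) {n : ℕ} (S : Fin n → ℝ × Bool) :
    Prop where
  mem : ∀ l, (S l).1 ∈ X
  le_card : ∀ k : ℕ, 1 ≤ k → 3 * L ≤ k → k ≤ n → c * k / n < r₀ → ∀ z ∈ X,
    k ≤ (Finset.univ.filter fun l => dist (S l).1 z ≤ 4 * (c * k / n)).card
  deviation : ∀ i j, let A := Finset.univ.filter fun l => (S i).1 ≤ (S l).1 ∧ (S l).1 ≤ (S j).1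
    A.Nonempty →
      |∑ l ∈ A, ((if (S l).2 = true then 1 else 0) - h (S l).1)| < √(A.card * (2 * L))

/-- Since `e^{-L} = ν/n`, a sparse heavy cell has probability at most `n(ν/n)³` for each `k ≥ 3L`,
and a label deviation at most `2n²(ν/n)⁴`. Summed over `k ≤ n`, the total is `ν³/n + 2ν⁴/n²`, at
most `ν` once `n ≥ 2`. -/
theorem RegularData.measure_not_isGoodSample_le [IsProbabilityMeasure Q]
    (hQ : RegularData Q X h ω r₀ p₀ Cρ ρ Cβ β) (hω : 0 < ω) (hp₀ : 0 < p₀) {n : ℕ} (hn : 2 ≤ n)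
    {ν : ℝ} (hν : 0 < ν) (hν1 : ν < 1) :
    (Measure.pi fun _ : Fin n => Q)
      {S | ¬ IsGoodSample X h r₀ (4 / (p₀ * ω)) (Real.log n + Real.log (1 / ν)) S}
      ≤ ENNReal.ofReal ν := by
  classical
  set L := Real.log n + Real.log (1 / ν) with hL
  have hn2 : (2 : ℝ) ≤ n := by exact_mod_cast hn
  have hn0 : (0 : ℝ) < n := by linarith
  have hL0 : 0 ≤ L := add_nonneg (Real.log_nonneg (by linarith))
    (Real.log_nonneg (by rw [le_div_iff₀ hν]; linarith))
  have hexp : Real.exp (-L) = ν / n := by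
    rw [hL, ← Real.log_mul hn0.ne' (by positivity), Real.exp_neg, Real.exp_log (by positivity)]
    field_simp
  -- At `s = ck/n` the cell mass `p₀ωs` equals `4k/n`, exactly what the Chernoff bound requires.
  let c := 4 / (p₀ * ω)
  have hc : 0 < c := by positivity
  let B₀ : Set (Fin n → ℝ × Bool) := {S | ¬ ∀ l, (S l).1 ∈ X}
  let B₁ : ℕ → Set (Fin n → ℝ × Bool) := fun k => {S | 3 * L ≤ k ∧
    ∃ j : ℤ, 4 * (k : ℝ) ≤ n * Q.real {p | ⌊p.1 / (3 * (c * k / n))⌋ = j} ∧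
      (Finset.univ.filter fun i => S i ∈ {p : ℝ × Bool | ⌊p.1 / (3 * (c * k / n))⌋ = j}).card < k}
  let B₂ : Set (Fin n → ℝ × Bool) := {S | ∃ i j,
    let A := Finset.univ.filter fun l => (S i).1 ≤ (S l).1 ∧ (S l).1 ≤ (S j).1
    A.Nonempty ∧ √(A.card * (2 * L)) ≤
      |∑ l ∈ A, ((if (S l).2 = true then 1 else 0) - h (S l).1)|}
  have hsub : {S : Fin n → ℝ × Bool | ¬ IsGoodSample X h r₀ c L S} ⊆
      B₀ ∪ (⋃ k ∈ Finset.Icc 1 n, B₁ k) ∪ B₂ := by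
    intro S hS
    by_contra hnot
    simp only [Set.mem_union, not_or] at hnot
    obtain ⟨⟨h0, h1⟩, h2⟩ := hnot
    refine hS ⟨not_not.1 h0, fun k hk1 hkL hkn hkr z hz => ?_, fun i j hA => ?_⟩
    · have hk0 : (0 : ℝ) < k := by exact_mod_cast hk1
      obtain ⟨j, hj, hjz⟩ := hQ.exists_heavy_cell hω hp₀ hz
        (by positivity : 0 < c * k / n) hkr
      have hheavy : 4 * (k : ℝ) ≤ n * Q.real {p | ⌊p.1 / (3 * (c * k / n))⌋ = j} := by
        have : p₀ * ω * (c * k / n) = 4 * k / n := by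
          simp only [c]; field_simp
        rw [this, div_le_iff₀' hn0] at hj
        exact hj
      by_contra! hlt
      refine h1 (Set.mem_biUnion (Finset.mem_coe.2 (Finset.mem_Icc.2 ⟨hk1, hkn⟩))
        ⟨hkL, j, hheavy, lt_of_le_of_lt (Finset.card_le_card ?_) hlt⟩)
      exact Finset.monotone_filter_right _ fun l _ hl => hjz _ hl
    · by_contra! hle
      exact h2 ⟨i, j, hA, hle⟩
  have hB₀ : (Measure.pi fun _ : Fin n => Q) B₀ = 0 := by
    have h1 : ∀ l, ∀ᵐ S ∂(Measure.pi fun _ : Fin n => Q), (S l).1 ∈ X := by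
      intro l
      have h2 : ∀ᵐ p ∂Q, p.1 ∈ X := ae_of_ae_map (by fun_prop) hQ.ae_mem
      exact (Measure.quasiMeasurePreserving_eval (fun _ : Fin n => Q) l).ae h2
    exact ae_iff.1 (ae_all_iff.2 h1)
  have hB₁ : ∀ k ∈ Finset.Icc 1 n, (Measure.pi fun _ : Fin n => Q) (B₁ k)
      ≤ ENNReal.ofReal (n * (ν / n) ^ 3) := by
    intro k hk
    by_cases hkL : 3 * L ≤ k
    · have hcells := measure_exists_card_filter_lt_le (P := Q) (n := n)
        (C := fun j : ℤ => {p : ℝ × Bool | ⌊p.1 / (3 * (c * k / n))⌋ = j})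
        (Finset.mem_Icc.1 hk).1
        (fun j => (measurable_fst.div_const _).floor (measurableSet_singleton j))
        (fun i j hij => Set.disjoint_left.2 fun p hi hj => hij (hi.symm.trans hj))
      refine (measure_mono ?_).trans (hcells.trans (ENNReal.ofReal_le_ofReal ?_))
      · rintro S ⟨-, j, h1, h2⟩
        exact ⟨j, h1, by convert! h2⟩
      · refine mul_le_mul_of_nonneg_left ?_ hn0.le
        rw [← hexp, ← Real.exp_nat_mul]
        exact Real.exp_le_exp.2 (by push_cast; linarith)
    · simp [B₁, hkL]
  have hB₂ : (Measure.pi fun _ : Fin n => Q) B₂ ≤ ENNReal.ofReal (n ^ 2 * (2 * (ν / n) ^ 4)) := by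
    have := hQ.regression.measure_exists_label_deviation_le (n := n) (t := 2 * L) (by linarith)
    rw [← hexp, ← Real.exp_nat_mul]
    convert! this using 5
    push_cast; ring
  calc _ ≤ (Measure.pi fun _ : Fin n => Q) (B₀ ∪ (⋃ k ∈ Finset.Icc 1 n, B₁ k) ∪ B₂) :=
        measure_mono hsub
    _ ≤ 0 + ∑ k ∈ Finset.Icc 1 n, ENNReal.ofReal (n * (ν / n) ^ 3)
          + ENNReal.ofReal (n ^ 2 * (2 * (ν / n) ^ 4)) := by
        refine (measure_union_le _ _).trans (add_le_add ((measure_union_le _ _).trans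
          (add_le_add hB₀.le ?_)) hB₂)
        exact (measure_biUnion_finset_le _ _).trans (Finset.sum_le_sum hB₁)
    _ = ENNReal.ofReal (n * (n * (ν / n) ^ 3) + n ^ 2 * (2 * (ν / n) ^ 4)) := by
        rw [zero_add, Finset.sum_const, Nat.card_Icc, Nat.add_sub_cancel, ← ENNReal.ofReal_nsmul,
          nsmul_eq_mul, ← ENNReal.ofReal_add (by positivity) (by positivity)]
    _ ≤ ENNReal.ofReal ν := by
        refine ENNReal.ofReal_le_ofReal ?_
        have h1 : (n : ℝ) * (n * (ν / n) ^ 3) = ν ^ 3 / n := by field_simp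
        have h2 : (n : ℝ) ^ 2 * (2 * (ν / n) ^ 4) = 2 * ν ^ 4 / n ^ 2 := by field_simp
        have h3 : ν ^ 3 ≤ ν := pow_le_of_le_one hν.le hν1.le (by norm_num)
        have h4 : ν ^ 4 ≤ ν := pow_le_of_le_one hν.le hν1.le (by norm_num)
        have h5 : ν ^ 3 / n ≤ ν / 2 := by gcongr
        have h6 : 2 * ν ^ 4 / n ^ 2 ≤ 2 * ν / 2 ^ 2 := by gcongr
        rw [h1, h2]
        linarith

end Line

/-! ### From good samples to rates -/

section Rate

variable {Q : Measure (ℝ × Bool)} {X : Set ℝ} {h : ℝ → ℝ} {ω r₀ p₀ Cρ ρ Cβ β : ℝ}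

/-- The choice `K_u = 1/(16c)` gives separation `16ck/n`, twice the diameter bound `8ck/n` of the
neighbourhood, so the inequality is strict. -/
theorem separated_of_KRange {m n k : ℕ} {b : Fin m → ℝ} {Kl c ρ ν : ℝ} (hc : 0 < c) (hn : 0 < n)
    (hk0 : 0 < k) (hk : KRange Kl (1 / (16 * c)) ρ ν 1 n (minPairwiseDist b) k) {i j : Fin m}
    (hij : i ≠ j) : 2 * (4 * (c * k / n)) < dist (b i) (b j) := by
  have hn0 : (0 : ℝ) < n := by exact_mod_cast hn
  have hk0 : (0 : ℝ) < k := by exact_mod_cast hk0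
  have h1 : (k : ℝ≥0∞) ≤ ENNReal.ofReal (1 / (16 * c) * dist (b i) (b j) * n) := by
    rw [ENNReal.ofReal_mul (by positivity), ENNReal.ofReal_mul (by positivity), ← edist_dist,
      ENNReal.ofReal_natCast]
    refine hk.2.trans ?_
    rw [pow_one]
    gcongr
    exact iInf_le_of_le i (iInf_le_of_le j (iInf_le _ hij))
  rw [← ENNReal.ofReal_natCast, ENNReal.ofReal_le_ofReal_iff (by positivity)] at h1
  have h2 : 16 * (c * k / n) ≤ dist (b i) (b j) := by
    rw [one_div_mul_eq_div, div_mul_eq_mul_div, le_div_iff₀ (by positivity)] at h1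
    rw [← mul_div_assoc, div_le_iff₀ hn0]
    linarith
  have h3 : 0 < c * k / n := by positivity
  linarith

theorem pos_of_KRange {n k : ℕ} {Kl Ku ρ ν : ℝ} {Δ : ℝ≥0∞} (hKl : 0 < Kl) (hn : 0 < n)
    (hν : 0 < ν) (hν1 : ν < 1) (hk : KRange Kl Ku ρ ν 1 n Δ k) : 0 < k := by
  have h1 : 0 < Real.log (1 / ν) := Real.log_pos (by rw [lt_div_iff₀ hν]; linarith)
  have h2 : (0 : ℝ) < n := by exact_mod_cast hn
  have h3 : (0 : ℝ) < k := lt_of_lt_of_le (by positivity) hk.1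
  exact_mod_cast h3

/-- The margin beyond which the vote is correct, in units of the rate. -/
noncomputable def marginConst (p₀ ω Cρ ρ : ℝ) : ℝ := Cρ * (4 * (4 / (p₀ * ω))) ^ ρ + 6

/-- The bounds of the theorem are trivial at rates above this threshold. -/
noncomputable def rateThreshold (p₀ ω r₀ ρ : ℝ) : ℝ := min (1 / 2) ((r₀ / (4 / (p₀ * ω))) ^ ρ)

theorem IsGoodSample.knnClassifier_eq (hQ : RegularData Q X h ω r₀ p₀ Cρ ρ Cβ β)
    (hω : 0 < ω) (hr₀ : 0 < r₀) (hp₀ : 0 < p₀) (hCρ : 0 < Cρ) (hρ : 0 < ρ) {n m k : ℕ}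
    (hn : 2 ≤ n) {ν : ℝ} (hν : 0 < ν) (hν1 : ν < 1) {S : Fin n → ℝ × Bool}
    (hS : IsGoodSample X h r₀ (4 / (p₀ * ω)) (Real.log n + Real.log (1 / ν)) S)
    {b : Fin m → ℝ} {lb : Fin m → Bool}
    (hk : KRange 1 (1 / (16 * (4 / (p₀ * ω)))) ρ ν 1 n (minPairwiseDist b) k)
    (hsmall : rate ρ ν 1 n k < rateThreshold p₀ ω r₀ ρ) {z : ℝ} (hz : z ∈ X)
    (hmargin : marginConst p₀ ω Cρ ρ * rate ρ ν 1 n k ≤ |h z - 1 / 2|) :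
    knnClassifier k (Sum.elim (fun i => (S i).1) b) (Sum.elim (fun i => (S i).2) lb) z
      = bayesClassifier h z := by
  set L := Real.log n + Real.log (1 / ν) with hL
  set c := 4 / (p₀ * ω) with hcdef
  have hc : 0 < c := by positivity
  have hk0 := pos_of_KRange one_pos (by omega) hν hν1 hk
  have hk0' : (0 : ℝ) < k := by exact_mod_cast hk0
  have hn2 : (2 : ℝ) ≤ n := by exact_mod_cast hn
  have hn0 : (0 : ℝ) < n := by linarith
  have hL2 : 1 / 2 ≤ L := by
    have h1 := Real.log_le_log (by norm_num) hn2
    have h2 := Real.log_two_gt_d9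
    have h3 : 0 ≤ Real.log (1 / ν) := Real.log_nonneg (by rw [le_div_iff₀ hν]; linarith)
    linarith
  set r := rate ρ ν 1 n k with hr
  have hreq : r = √(L / k) + ((k : ℝ) / n) ^ ρ := by simp [hr, rate, hL]
  have hpow0 : 0 ≤ ((k : ℝ) / n) ^ ρ := by positivity
  have hsq : √(L / k) ≤ r := by rw [hreq]; linarith
  have hpow : ((k : ℝ) / n) ^ ρ ≤ r := by rw [hreq]; linarith [Real.sqrt_nonneg (L / k)]
  -- A small rate supplies all the size conditions: `k ≤ n` and `ck/n < r₀` from its second summand,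
  -- `4L ≤ k` from its first. With `L ≥ 1/2` the last gives `k ≥ 2`.
  have hr2 : r < 1 / 2 := hsmall.trans_le (min_le_left _ _)
  have hkn : k ≤ n := by
    by_contra! hlt
    have h1 : (1 : ℝ) ≤ k / n := by
      rw [le_div_iff₀ hn0, one_mul]; exact_mod_cast hlt.le
    linarith [Real.one_le_rpow h1 hρ.le]
  have hkL : 4 * L ≤ k := by
    have h1 : √(L / k) < 1 / 2 := hsq.trans_lt hr2
    rw [Real.sqrt_lt' (by norm_num), div_lt_iff₀ hk0'] at h1
    linarith
  have hk2 : 2 ≤ k := by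
    have : (2 : ℝ) ≤ k := by linarith
    exact_mod_cast this
  have hkr : c * k / n < r₀ := by
    have h1 : ((k : ℝ) / n) ^ ρ < (r₀ / c) ^ ρ :=
      (hpow.trans_lt hsmall).trans_le (min_le_right _ _)
    have h2 := (Real.rpow_lt_rpow_iff (by positivity) (by positivity) hρ).1 h1
    rw [lt_div_iff₀ hc] at h2
    rw [mul_div_assoc, mul_comm]
    exact h2
  have hball := hS.le_card k hk0 (by linarith) hkn hkr z hz
  refine knnClassifier_eq_bayesClassifier (R := 4 * (c * k / n)) (t := 2 * L)
    (τ := marginConst p₀ ω Cρ ρ * r) (ε := Cρ * (4 * (c * k / n)) ^ ρ) hk2 ?_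
    (fun i j hij => separated_of_KRange hc (by omega) hk0 hk hij)
    ?_ (fun l hl => ?_) (fun N hN => ?_) hmargin
  · convert! hball
  · intro i j
    convert! hS.deviation i j
  · refine (hQ.holder _ (hS.mem l) _ hz).trans ?_
    gcongr
  · have hN2 : (k : ℝ) ≤ 2 * N := by
      have : k ≤ 2 * N := by omega
      exact_mod_cast this
    have hN0 : (0 : ℝ) < N := by linarith
    have hN1 : (1 : ℝ) ≤ N := by
      have : 1 ≤ N := by omega
      exact_mod_cast this
    -- The first summand of `marginConst` pays for the Hölder oscillation. The remaining `6` splits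
    -- into `2` for the label fluctuation and `4` for the stray vote.
    have hgap : 6 * r ≤ marginConst p₀ ω Cρ ρ * r - Cρ * (4 * (c * k / n)) ^ ρ := by
      have h1 : (4 * (c * k / n)) ^ ρ = (4 * c) ^ ρ * ((k : ℝ) / n) ^ ρ := by
        rw [← Real.mul_rpow (by positivity) (by positivity)]
        congr 1; ring
      have h2 : Cρ * (4 * (c * k / n)) ^ ρ ≤ Cρ * (4 * c) ^ ρ * r := by
        rw [h1, mul_assoc]
        gcongr
      rw [marginConst, ← hcdef]
      linarith
    have h1 : √(N * (2 * L)) ≤ 2 * (N * r) := by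
      calc √(N * (2 * L)) ≤ √((2 * N) ^ 2 * (L / k)) := by
            refine Real.sqrt_le_sqrt ?_
            rw [← mul_div_assoc, le_div_iff₀ hk0']
            calc (N : ℝ) * (2 * L) * k ≤ N * (2 * L) * (2 * N) := by gcongr
              _ = _ := by ring
        _ = 2 * N * √(L / k) := by
            rw [Real.sqrt_mul (by positivity), Real.sqrt_sq (by positivity)]
        _ ≤ 2 * N * r := by gcongr
        _ = _ := by ring
    -- `L ≥ 1/2` and `k ≤ 2N` give `16N²L ≥ 8N² ≥ k`.
    have h2 : 1 ≤ 4 * (N * r) := by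
      calc (1 : ℝ) ≤ √((4 * N) ^ 2 * (L / k)) := by
            rw [Real.one_le_sqrt, ← mul_div_assoc, le_div_iff₀ hk0', one_mul]
            nlinarith
        _ = 4 * N * √(L / k) := by
            rw [Real.sqrt_mul (by positivity), Real.sqrt_sq (by positivity)]
        _ ≤ 4 * N * r := by gcongr
        _ = _ := by ring
    have h3 : N * (6 * r) ≤
        N * (marginConst p₀ ω Cρ ρ * r - Cρ * (4 * (c * k / n)) ^ ρ) := by gcongr
    linarith

theorem marginConst_pos (hω : 0 < ω) (hp₀ : 0 < p₀) (hCρ : 0 < Cρ) :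
    0 < marginConst p₀ ω Cρ ρ := by
  unfold marginConst; positivity

theorem rateThreshold_pos (hω : 0 < ω) (hp₀ : 0 < p₀) (hr₀ : 0 < r₀) :
    0 < rateThreshold p₀ ω r₀ ρ := lt_min (by norm_num) (by positivity)

/-- Supplies the constants that make the bounds trivial when the rate is at least the threshold. -/
theorem one_le_rpow_neg_mul_rpow {x₀ x γ : ℝ} (hx₀ : 0 < x₀) (hx : x₀ ≤ x) (hγ : 0 ≤ γ) :
    1 ≤ x₀ ^ (-γ) * x ^ γ := by
  rw [Real.rpow_neg hx₀.le, ← div_eq_inv_mul, one_le_div (by positivity)]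
  exact Real.rpow_le_rpow hx₀.le hx hγ

theorem rate_nonneg {n k d : ℕ} {ν : ℝ} : 0 ≤ rate ρ ν d n k := by
  unfold rate; positivity

theorem one_le_rate_of_le {n k : ℕ} {ν : ℝ} (hρ : 0 < ρ) (hn : 1 ≤ n) (hk : n ≤ k) :
    1 ≤ rate ρ ν 1 n k := by
  have hn0 : (0 : ℝ) < n := by exact_mod_cast hn
  have h1 : (1 : ℝ) ≤ k / n := by
    rw [le_div_iff₀ hn0, one_mul]; exact_mod_cast hk
  have h2 := Real.one_le_rpow h1 hρ.le
  simp only [rate, Nat.cast_one, div_one]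
  linarith [Real.sqrt_nonneg ((Real.log n + Real.log (1 / ν)) / k)]

/-- The error bounds for a classifier that is correct wherever the margin exceeds a multiple of
the rate `r`; at rates `r ≥ r₁` they hold for every classifier. -/
theorem RegularData.error_bounds [IsProbabilityMeasure Q]
    (hQ : RegularData Q X h ω r₀ p₀ Cρ ρ Cβ β) (hCβ : 0 < Cβ) (hβ : 0 < β) {C r r₁ : ℝ}
    (hC : 0 < C) (hr : 0 ≤ r) (hr₁ : 0 < r₁) {g : ℝ → Bool} (hg : Measurable g)
    (hgood : r < r₁ → 0 < r ∧ ∀ z ∈ X, C * r ≤ |h z - 1 / 2| → g z = bayesClassifier h z) :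
    (Q.map Prod.fst).real {x | g x ≠ bayesClassifier h x}
        ≤ (Cβ * C ^ β + r₁ ^ (-β)) * r ^ β ∧
      risk Q g - risk Q (bayesClassifier h)
        ≤ (2 * C * (Cβ * C ^ β) + r₁ ^ (-(β + 1))) * r ^ (β + 1) := by
  rcases lt_or_ge r r₁ with hlt | hge
  · obtain ⟨hr0, hcorrect⟩ := hgood hlt
    have hae : ∀ᵐ x ∂(Q.map Prod.fst), C * r ≤ |h x - 1 / 2| → g x = bayesClassifier h x := by
      filter_upwards [hQ.ae_mem] with x hx using hcorrect x hx
    have htsy := hQ.tsybakov (C * r) (by positivity)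
    rw [Real.mul_rpow hC.le hr] at htsy
    constructor
    · have h1 : 0 ≤ r₁ ^ (-β) * r ^ β := by positivity
      linarith [real_ne_bayesClassifier_le hae]
    · refine (hQ.regression.risk_sub_le hg hae).trans ?_
      have h1 : 0 ≤ r₁ ^ (-(β + 1)) * r ^ (β + 1) := by positivity
      have h2 : r ^ (β + 1) = r ^ β * r := by rw [Real.rpow_add_one hr0.ne']
      calc _ ≤ 2 * (C * r) * (Cβ * (C ^ β * r ^ β)) := by gcongr
        _ = 2 * C * (Cβ * C ^ β) * r ^ (β + 1) := by rw [h2]; ring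
        _ ≤ _ := by linarith
  · have h1 := one_le_rpow_neg_mul_rpow hr₁ hge hβ.le
    have h2 := one_le_rpow_neg_mul_rpow hr₁ hge (by linarith : 0 ≤ β + 1)
    constructor
    · have h3 : 0 ≤ Cβ * C ^ β * r ^ β := by positivity
      have h4 : (Q.map Prod.fst).real {x | g x ≠ bayesClassifier h x} ≤ 1 := measureReal_le_one
      linarith
    · have h3 : 0 ≤ 2 * C * (Cβ * C ^ β) * r ^ (β + 1) := by positivity
      have h4 : risk Q g ≤ 1 := measureReal_le_one
      have h5 : 0 ≤ risk Q (bayesClassifier h) := measureReal_nonneg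
      linarith

end Rate

/-! ### Back to `ℝ^d` -/

section Transfer

variable {d : ℕ} {μ : Measure (EuclideanSpace ℝ (Fin d) × Bool)} [IsProbabilityMeasure μ]
  {η : EuclideanSpace ℝ (Fin d) → ℝ} {X : Set ℝ} {h : ℝ → ℝ} {ω r₀ p₀ Cρ ρ Cβ β : ℝ}

/-- In dimension zero the norm is constantly `0`, and a point mass has no density. -/
theorem RegularData.dim_ne_zero (hQ : RegularData (normLaw μ) X h ω r₀ p₀ Cρ ρ Cβ β) :
    d ≠ 0 := by
  rintro rfl
  obtain ⟨p, -, hpQ, -⟩ := hQ.density_bounded_below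
  have h0 : ((normLaw μ).map Prod.fst) {0} = 0 := by
    rw [hpQ]
    exact (withDensity_absolutelyContinuous _ _)
      (Measure.restrict_le_self.absolutelyContinuous Real.volume_singleton)
  rw [normLaw, map_fst_map measurable_norm, Measure.map_apply measurable_norm
    (measurableSet_singleton _)] at h0
  have h1 : (fun x : EuclideanSpace ℝ (Fin 0) => ‖x‖) ⁻¹' {0} = Set.univ := by
    ext x
    simp [Subsingleton.elim x 0]
  rw [h1, measure_univ] at h0
  exact one_ne_zero h0

/-- For a rotation-invariant Bayes rule, the error of a classifier of the norm is its error on the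
represented data. -/
theorem SOInvariant.error_eq (hη : IsRegressionFunction μ η)
    (hinv : SOInvariant (bayesClassifier η))
    (h1 : d = 1 → ∀ x, bayesClassifier η (-x) = bayesClassifier η x)
    (hQ : RegularData (normLaw μ) X h ω r₀ p₀ Cρ ρ Cβ β) {g : ℝ → Bool} (hg : Measurable g) :
    (μ.map Prod.fst).real {x | g ‖x‖ ≠ bayesClassifier η x} =
        ((normLaw μ).map Prod.fst).real {r | g r ≠ bayesClassifier h r} ∧
      risk μ (fun x => g ‖x‖) - bayesRisk μ =
        risk (normLaw μ) g - risk (normLaw μ) (bayesClassifier h) := by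
  obtain ⟨f, hf, hfac⟩ := hinv.exists_factor hQ.dim_ne_zero h1 hη.measurable_bayesClassifier
  have hae := bayesClassifier_ae_eq_of_factor measurable_norm hη hQ.regression hf hfac
  have hmeas := hQ.regression.measurable_bayesClassifier
  have hne : MeasurableSet {r | g r ≠ bayesClassifier h r} :=
    (measurableSet_eq_fun hg hmeas).compl
  constructor
  · rw [normLaw, map_fst_map measurable_norm, map_measureReal_apply measurable_norm hne]
    refine measureReal_congr ?_
    filter_upwards [hae] with x hx
    change (g ‖x‖ ≠ bayesClassifier η x) = (g ‖x‖ ≠ bayesClassifier h ‖x‖)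
    rw [hx]
  · rw [hη.bayesRisk_eq, risk_congr_ae hae, normLaw, risk_map measurable_norm hg,
      risk_map measurable_norm hmeas]

end Transfer

end InvariantKNN

open InvariantKNN in
/-- The constants depend only on the parameters of the one-dimensional represented data
`(‖X‖₂, Y)`, not on the ambient dimension `d`, so that every `k` in the range of dimension `1`
works for all `d` at once. The labeling function is the Bayes rule of the data; deterministic
labels `Y = f(X)` are the case where `η` is the indicator of `f = 1`. -/
theorem mainTheorem4
    (ω r₀ p₀ Cρ ρ Cβ β : ℝ)
    (hω : 0 < ω) (hr₀ : 0 < r₀) (hp₀ : 0 < p₀) (hCρ : 0 < Cρ) (hρ : 0 < ρ) (hρ1 : ρ ≤ 1)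
    (hCβ : 0 < Cβ) (hβ : 0 < β) :
    ∃ Kl Ku K K' : ℝ, 0 < Kl ∧ 0 < Ku ∧ 0 < K ∧ 0 < K' ∧
      ∀ (d : ℕ) (μ : Measure (EuclideanSpace ℝ (Fin d) × Bool)) [IsProbabilityMeasure μ]
        (η : EuclideanSpace ℝ (Fin d) → ℝ), IsRegressionFunction μ η →
        SOInvariant (bayesClassifier η) →
        -- `SO(1)` is trivial: for `d = 1` ask that the norm retains the label
        (d = 1 → ∀ x, bayesClassifier η (-x) = bayesClassifier η x) →
        ∀ (X : Set ℝ) (h : ℝ → ℝ), RegularData (normLaw μ) X h ω r₀ p₀ Cρ ρ Cβ β →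
        ∀ (n : ℕ) (ν : ℝ), 1 ≤ n → 0 < ν → ν < 1 →
          (Measure.pi fun _ : Fin n => μ)
            {S | ¬ ∀ (m : ℕ) (c : Fin m → EuclideanSpace ℝ (Fin d) × Bool) (k : ℕ),
              KRange Kl Ku ρ ν 1 n (minPairwiseDist fun j => ‖(c j).1‖) k →
                (μ.map Prod.fst).real
                    {x | repKnnClassifier (fun x => ‖x‖) k S c x ≠ bayesClassifier η x}
                  ≤ K * rate ρ ν 1 n k ^ β ∧
                risk μ (repKnnClassifier (fun x => ‖x‖) k S c) - bayesRisk μ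
                  ≤ K' * rate ρ ν 1 n k ^ (β + 1)}
            ≤ ENNReal.ofReal ν := by
  have hC : 0 < marginConst p₀ ω Cρ ρ := marginConst_pos hω hp₀ hCρ
  have hT : 0 < rateThreshold p₀ ω r₀ ρ := rateThreshold_pos hω hp₀ hr₀
  -- Any positive `K_l` would do: the lower end of the range only has to give `k > 0`, because too
  -- small a `k` makes the rate large and the bounds trivial.
  refine ⟨1, 1 / (16 * (4 / (p₀ * ω))),
    Cβ * marginConst p₀ ω Cρ ρ ^ β + rateThreshold p₀ ω r₀ ρ ^ (-β),
    2 * marginConst p₀ ω Cρ ρ * (Cβ * marginConst p₀ ω Cρ ρ ^ β)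
      + rateThreshold p₀ ω r₀ ρ ^ (-(β + 1)),
    one_pos, by positivity, by positivity, by positivity, ?_⟩
  intro d μ _ η hη hinv h1 X h hQ n ν hn hν hν1
  have hP : IsProbabilityMeasure (normLaw μ) := Measure.isProbabilityMeasure_map (by fun_prop)
  have hsf : SigmaFinite (normLaw μ) := inferInstance
  let Φ : (Fin n → EuclideanSpace ℝ (Fin d) × Bool) → Fin n → ℝ × Bool :=
    fun S i => (‖(S i).1‖, (S i).2)
  have hΦ : Measurable Φ := by fun_prop
  have hpi : (Measure.pi fun _ : Fin n => μ).map Φ = Measure.pi fun _ : Fin n => normLaw μ :=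
    Measure.pi_map_pi (μ := fun _ : Fin n => μ)
      (f := fun _ (p : EuclideanSpace ℝ (Fin d) × Bool) => (‖p.1‖, p.2))
      (hμ := fun _ => hsf) fun _ => by fun_prop
  -- For `n = 1` no event need be excluded: then `k ≥ n`, the rate is at least `1`, and the bounds
  -- are trivial.
  let B : Set (Fin n → ℝ × Bool) := {S | 2 ≤ n ∧
    ¬ IsGoodSample X h r₀ (4 / (p₀ * ω)) (Real.log n + Real.log (1 / ν)) S}
  have hB : (Measure.pi fun _ : Fin n => normLaw μ) B ≤ ENNReal.ofReal ν := by
    by_cases hn2 : 2 ≤ n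
    · exact (measure_mono fun S hS => hS.2).trans
        (hQ.measure_not_isGoodSample_le hω hp₀ hn2 hν hν1)
    · simp [B, hn2]
  -- The inequality `Measure.le_map_apply` holds for arbitrary sets, so the bad events need not be
  -- measurable.
  refine (measure_mono ?_).trans
    ((Measure.le_map_apply hΦ.aemeasurable B).trans ((congrArg (· B) hpi).trans_le hB))
  intro S hS
  by_contra hSB
  refine hS fun m c k hk => ?_
  have hk0 := pos_of_KRange one_pos hn hν hν1 hk
  have hg := measurable_knnClassifier k
    (Sum.elim (fun i => (Φ S i).1) (fun j => ‖(c j).1‖))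
    (Sum.elim (fun i => (Φ S i).2) (fun j => (c j).2))
  obtain ⟨he1, he2⟩ := hinv.error_eq hη h1 hQ hg
  have hbounds := hQ.error_bounds hCβ hβ hC (rate_nonneg (ρ := ρ) (n := n) (k := k) (d := 1)
    (ν := ν)) hT hg ?_
  · rw [← he1, ← he2] at hbounds
    exact hbounds
  · intro hsmall
    have hT1 : rateThreshold p₀ ω r₀ ρ ≤ 1 / 2 := min_le_left _ _
    have hkn : k < n := by
      by_contra! hle
      linarith [one_le_rate_of_le (ν := ν) hρ hn hle]
    have hn2 : 2 ≤ n := by omega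
    have hgood : IsGoodSample X h r₀ (4 / (p₀ * ω)) (Real.log n + Real.log (1 / ν)) (Φ S) := by
      by_contra hnot
      exact hSB ⟨hn2, hnot⟩
    refine ⟨?_, fun z hz hmargin =>
      hgood.knnClassifier_eq hQ hω hr₀ hp₀ hCρ hρ hn2 hν hν1 hk hsmall hz hmargin⟩
    exact add_pos_of_nonneg_of_pos (Real.sqrt_nonneg _) (by positivity)
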